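/- Conventions: all groups are countable and discrete, and abelian groups are written additively. For a group $G$, let $L(G)=\{\lambda_g : g\in G\}''\subset B(\ell^2(G))$ be the group von Neumann algebra generated by the left regular representation, and let $L(G)\cong L(\Lambda)$ denote $*$-isomorphism. A countable group $G$ is called W$^*$-superrigid if for every countable group $\Lambda$ one has $L(G)\cong L(\Lambda)$ if and only if $G\cong\Lambda$. For an abelian group $C$ with trivial $G$-action, $H^2(G,C)$ is the group of normalized 2-cocycles $\Omega:G\times G\to C$ (that is, $\Omega(g,h)+\Omega(gh,k)=\Omega(g,hk)+\Omega(h,k)$ and $\Omega(g,e)=0=\Omega(e,g)$) modulo the coboundaries $(g,h)\mapsto F(g)+F(h)-F(gh)$ with $F(e)=0$. The central extension of $G$ by $C$ corresponding to $\Omega\in H^2(G,C)$ is the set $C\times G$ with the product $(a,g)(b,h)=(a+b+\Omega(g,h),gh)$, which up to isomorphism of extensions does not depend on the representing cocycle. For $\Omega,\Omega'\in H^2(G,C)$ we write $\Omega\approx\Omega'$ if $\omega\circ\Omega=\omega\circ\Omega'$ in $H^2(G,\mathbb T)$ for every group homomorphism $\omega:C\to\mathbb T$. Proposition. Let $\Gamma$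 be a countable group, $I$ a set with at least two elements and $\Gamma\curvearrowright I$ a faithful transitive action such that $(\mathrm{Stab}_\Gamma\, i)\cdot j$ is infinite for all $i\neq j$ in $I$. Let $n\geq 1$ be an integer and let $G=(\mathbb Z/n\mathbb Z)^{(I)}\rtimes\Gamma$ be the generalized wreath product group, where $(\mathbb Z/n\mathbb Z)^{(I)}$ is the direct sum and $\Gamma$ acts on it by permuting the coordinates. Let $C$ be a countable abelian group with $n\cdot C\neq C$. Then no central extension $\widetilde G$ of $G$ by $C$ is W$^*$-superrigid. More precisely, for every $\Omega\in H^2(G,C)$ there exists an $\Omega'\in H^2(G,C)$ such that $\Omega\approx\Omega'$ and such that the corresponding central extensions $\widetilde G$ and $\widetilde\Lambda$ of $G$ by $C$ satisfy $L(\widetilde G)\cong L(\widetilde\Lambda)$ and $\widetilde G\not\cong\widetilde\Lambda$. -/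

import Mathlib

open scoped ENNReal

namespace GroupVN

section VonNeumann

/-- The Hilbert space `ℓ²(G)`. -/
abbrev EllTwo (G : Type*) : Type _ := lp (fun _ : G => ℂ) 2

theorem memlp_translate {G : Type*} [Group G] (g : G) (f : EllTwo G) :
    Memℓp (fun h : G => f (g⁻¹ * h)) 2 := by
  have hp : 0 < (2 : ℝ≥0∞).toReal := by norm_num
  exact memℓp_gen (((lp.memℓp f).summable hp).comp_injective (mul_right_injective g⁻¹))

/-- The left regular representation: `(lam g f) h = f (g⁻¹ h)`. -/
noncomputable def lam {G : Type*} [Group G] (g : G) : EllTwo G →L[ℂ] EllTwo G :=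
  LinearIsometry.toContinuousLinearMap
    { toFun := fun f => ⟨fun h => f (g⁻¹ * h), memlp_translate g f⟩
      map_add' := fun _ _ => rfl
      map_smul' := fun _ _ => rfl
      norm_map' := fun f => by
        have hp : 0 < (2 : ℝ≥0∞).toReal := by norm_num
        rw [lp.norm_eq_tsum_rpow hp, lp.norm_eq_tsum_rpow hp]
        congr 1
        exact (Equiv.mulLeft g⁻¹).tsum_eq (fun h : G => ‖f h‖ ^ (2 : ℝ≥0∞).toReal) }

theorem lam_apply {G : Type*} [Group G] (g : G) (f : EllTwo G) (h : G) :
    lam g f h = f (g⁻¹ * h) := rfl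

/-- The von Neumann algebra generated by a set `S` of bounded operators: the double commutant
of `S ∪ S*`. -/
noncomputable def generatedVN {H : Type*} [NormedAddCommGroup H] [InnerProductSpace ℂ H]
    [CompleteSpace H] (S : Set (H →L[ℂ] H)) : VonNeumannAlgebra H where
  toStarSubalgebra := StarSubalgebra.centralizer ℂ
    (StarSubalgebra.centralizer ℂ S : Set (H →L[ℂ] H))
  centralizer_centralizer' := by simp

/-- The group von Neumann algebra `L(G)`, acting on `ℓ²(G)`. -/
noncomputable def groupVN (G : Type*) [Group G] : VonNeumannAlgebra (EllTwo G) :=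
  generatedVN (Set.range (lam (G := G)))

/-- `L(G) ≅ L(Λ)`: the two group von Neumann algebras are `*`-isomorphic. -/
def GroupVNIso (G Λ : Type*) [Group G] [Group Λ] : Prop :=
  Nonempty ((groupVN G).toStarSubalgebra ≃⋆ₐ[ℂ] (groupVN Λ).toStarSubalgebra)

/-- `G` is W*-superrigid: for every countable group `Λ`, one has `L(G) ≅ L(Λ)` if and only if
`G ≅ Λ`. (Every countable group has an isomorphic copy in the lowest universe.) -/
def IsWStarSuperrigid (G : Type*) [Group G] : Prop :=
  ∀ (Λ : Type) [Group Λ] [Countable Λ], GroupVNIso G Λ ↔ Nonempty (G ≃* Λ)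

end VonNeumann

section Cohomology

/-- Normalized 2-cocycles on `G` with values in the trivial `G`-module `A`. -/
def Z2 (G A : Type*) [Group G] [AddCommGroup A] : AddSubgroup (G → G → A) where
  carrier := {Ω | (∀ g h k, Ω g h + Ω (g * h) k = Ω g (h * k) + Ω h k) ∧
    ∀ g, Ω g 1 = 0 ∧ Ω 1 g = 0}
  zero_mem' := by simp
  add_mem' := by
    rintro Ω Ω' ⟨h, h0⟩ ⟨h', h0'⟩
    refine ⟨fun a b c => ?_, fun a => ?_⟩
    · have e := congrArg₂ (· + ·) (h a b c) (h' a b c)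
      simp only [Pi.add_apply]
      rw [add_add_add_comm, e, add_add_add_comm]
    · simp [h0 a, h0' a]
  neg_mem' := by
    rintro Ω ⟨h, h0⟩
    refine ⟨fun a b c => ?_, fun a => ?_⟩
    · simp only [Pi.neg_apply]
      rw [← neg_add, h a b c, neg_add]
    · simp [h0 a]

/-- Coboundaries `(g, h) ↦ F g + F h - F (g h)` of functions `F` with `F 1 = 0`. -/
def B2 (G A : Type*) [Group G] [AddCommGroup A] : AddSubgroup (Z2 G A) where
  carrier := {Ω | ∃ F : G → A, F 1 = 0 ∧ ∀ g h, Ω.1 g h = F g + F h - F (g * h)}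
  zero_mem' := ⟨0, by simp⟩
  add_mem' := by
    rintro Ω Ω' ⟨F, h0, h⟩ ⟨F', h0', h'⟩
    refine ⟨F + F', by simp [h0, h0'], fun a b => ?_⟩
    simp only [AddSubgroup.coe_add, Pi.add_apply, h, h']
    abel
  neg_mem' := by
    rintro Ω ⟨F, h0, h⟩
    refine ⟨-F, by simp [h0], fun a b => ?_⟩
    simp only [AddSubgroup.coe_neg, Pi.neg_apply, h]
    abel

/-- The second cohomology group `H²(G, A)` with trivial coefficients. -/
abbrev H2 (G A : Type*) [Group G] [AddCommGroup A] : Type _ := Z2 G A ⧸ B2 G A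

/-- The cohomology class of a cocycle. -/
def H2.mk {G A : Type*} [Group G] [AddCommGroup A] (Ω : Z2 G A) : H2 G A :=
  QuotientAddGroup.mk Ω

/-- `Ω ↦ φ ∘ Ω` on cocycles. -/
def Z2.map (G : Type*) {A B : Type*} [Group G] [AddCommGroup A] [AddCommGroup B] (φ : A →+ B) :
    Z2 G A →+ Z2 G B where
  toFun Ω := ⟨fun g h => φ (Ω.1 g h),
    fun a b c => by simpa using congrArg φ (Ω.2.1 a b c),
    fun a => by simp [Ω.2.2 a]⟩
  map_zero' := by ext; simp
  map_add' _ _ := by ext; simp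

/-- `Ω ↦ φ ∘ Ω` on cohomology. -/
def H2.map (G : Type*) {A B : Type*} [Group G] [AddCommGroup A] [AddCommGroup B] (φ : A →+ B) :
    H2 G A →+ H2 G B :=
  QuotientAddGroup.map (B2 G A) (B2 G B) (Z2.map G φ) (by
    rintro Ω ⟨F, h0, h⟩
    exact ⟨φ ∘ F, by simp [h0], fun a b => by simp [Z2.map, h]⟩)

/-- `Ω ≈ Ω'`: for every character `ω` of `C`, `ω ∘ Ω = ω ∘ Ω'` in `H²(G, 𝕋)`.
The circle group is written additively. -/
def CohApprox {G C : Type*} [Group G] [AddCommGroup C] (Ω Ω' : H2 G C) : Prop :=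
  ∀ ω : C →+ Additive Circle, H2.map G ω Ω = H2.map G ω Ω'

/-- The underlying set `C × G` of the central extension defined by a cocycle. -/
@[ext]
structure CocycleExt {G C : Type*} [Group G] [AddCommGroup C] (Ω : Z2 G C) where
  /-- the coordinate in `C` -/
  left : C
  /-- the coordinate in `G` -/
  right : G

/-- The group law `(a, g) (b, h) = (a + b + Ω(g, h), g h)`. -/
instance CocycleExt.instGroup {G C : Type*} [Group G] [AddCommGroup C] (Ω : Z2 G C) :
    Group (CocycleExt Ω) where
  mul x y := ⟨x.left + y.left + Ω.1 x.right y.right, x.right * y.right⟩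
  one := ⟨0, 1⟩
  inv x := ⟨-x.left - Ω.1 x.right⁻¹ x.right, x.right⁻¹⟩
  mul_assoc x y z := by
    refine CocycleExt.ext ?_ (mul_assoc _ _ _)
    change x.left + y.left + Ω.1 x.right y.right + z.left + Ω.1 (x.right * y.right) z.right
      = x.left + (y.left + z.left + Ω.1 y.right z.right) + Ω.1 x.right (y.right * z.right)
    have e := Ω.2.1 x.right y.right z.right
    calc _ = x.left + y.left + z.left
          + (Ω.1 x.right y.right + Ω.1 (x.right * y.right) z.right) := by abel
      _ = _ := by rw [e]; abel
  one_mul x := by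
    refine CocycleExt.ext ?_ (one_mul _)
    change 0 + x.left + Ω.1 1 x.right = x.left
    simp [(Ω.2.2 x.right).2]
  mul_one x := by
    refine CocycleExt.ext ?_ (mul_one _)
    change x.left + 0 + Ω.1 x.right 1 = x.left
    simp [(Ω.2.2 x.right).1]
  inv_mul_cancel x := by
    refine CocycleExt.ext ?_ (inv_mul_cancel _)
    change -x.left - Ω.1 x.right⁻¹ x.right + x.left + Ω.1 x.right⁻¹ x.right = 0
    abel

/-- The central extension `0 → C → CocycleExt Ω → G → 1` as an exact sequence. -/
def CocycleExt.toGroupExtension {G C : Type*} [Group G] [AddCommGroup C] (Ω : Z2 G C) :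
    GroupExtension (Multiplicative C) (CocycleExt Ω) G where
  inl :=
    { toFun := fun c => ⟨c.toAdd, 1⟩
      map_one' := rfl
      map_mul' := fun a b => CocycleExt.ext
        (show a.toAdd + b.toAdd = a.toAdd + b.toAdd + Ω.1 1 1 by simp [(Ω.2.2 1).1])
        (mul_one 1).symm }
  rightHom := { toFun := fun x => x.right, map_one' := rfl, map_mul' := fun _ _ => rfl }
  inl_injective := fun _ _ h => congrArg CocycleExt.left h
  range_inl_eq_ker_rightHom := by
    ext x
    constructor
    · rintro ⟨c, rfl⟩
      rfl
    · intro hx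
      exact ⟨Multiplicative.ofAdd x.left, CocycleExt.ext rfl (Eq.symm hx)⟩
  rightHom_surjective := fun g => ⟨⟨0, g⟩, rfl⟩

/-- An extension `1 → N → E → G → 1` is central if the image of `N` is central in `E`. -/
def IsCentralExtension {N E G : Type*} [Group N] [Group E] [Group G]
    (S : GroupExtension N E G) : Prop :=
  S.inl.range ≤ Subgroup.center E

theorem CocycleExt.isCentral {G C : Type*} [Group G] [AddCommGroup C] (Ω : Z2 G C) :
    IsCentralExtension (CocycleExt.toGroupExtension Ω) := by
  rintro _ ⟨c, rfl⟩
  refine Subgroup.mem_center_iff.2 fun x => CocycleExt.ext ?_ ?_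
  · change x.left + c.toAdd + Ω.1 x.right 1 = c.toAdd + x.left + Ω.1 1 x.right
    rw [(Ω.2.2 x.right).1, (Ω.2.2 x.right).2, add_comm x.left]
  · exact (mul_one _).trans (one_mul _).symm

end Cohomology

section Wreath

/-- The action of `Γ` on the direct sum `A^{(I)}` by translating coordinates,
`(g • a) i = a (g⁻¹ • i)`. -/
noncomputable def wreathAction (A Γ I : Type*) [AddCommGroup A] [Group Γ] [MulAction Γ I] :
    Γ →* MulAut (Multiplicative (I →₀ A)) where
  toFun g := AddEquiv.toMultiplicative (Finsupp.domCongr (MulAction.toPerm g))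
  map_one' := by
    ext a i
    change a.toAdd ((1 : Γ)⁻¹ • i) = a.toAdd i
    simp
  map_mul' g h := by
    ext a i
    change a.toAdd ((g * h)⁻¹ • i) = a.toAdd (h⁻¹ • g⁻¹ • i)
    rw [mul_inv_rev, mul_smul]

theorem wreathAction_apply {A Γ I : Type*} [AddCommGroup A] [Group Γ] [MulAction Γ I]
    (g : Γ) (a : I →₀ A) (i : I) :
    (wreathAction A Γ I g (Multiplicative.ofAdd a)).toAdd i = a (g⁻¹ • i) := rfl

/-- The generalized wreath product `A^{(I)} ⋊ Γ`. -/
abbrev GenWreath (A Γ I : Type*) [AddCommGroup A] [Group Γ] [MulAction Γ I] : Type _ :=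
  Multiplicative (I →₀ A) ⋊[wreathAction A Γ I] Γ

end Wreath

end GroupVN

open GroupVN

/-! Adding the coordinates of the base gives a homomorphism `s` from the wreath product `G` to
`ℤ/nℤ`. Inflating the carry cocycle `⌊(a + b) / n⌋ • c` along `s` and adding it to a given cocycle
`z` produces the competitor `z'`. Three facts make this work.

A character sends `c` to a point of the circle, which has an `n`-th root `r`. The carry then becomes
the coboundary of `s(g) • r`, with `s(g)` read in `{0, …, n - 1}`, so the two classes agree after
every character.

The same trick works inside the von Neumann algebra. The central unitary `λ_c` has a unitary `n`-th
root `W` in the bicommutant of `{λ_c, λ_c*}` (`exists_unitary_pow_eq`), and twisting `λ_x` to `W ^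
s(x) λ_x` converts one multiplication rule into the other. The twist is implemented by a unitary
between the `ℓ²` spaces (`groupVNIso_of_carry`).

The groups are told apart by whether a coordinate generator of the base lifts to an element with
trivial `n`-th power (`HasTorsionLift`). The obstruction lies in `C / nC`, and the carry shifts it
by `c`. As `nC ≠ C`, some `c` changes the answer: take `c ∉ nC` if a torsion lift exists, and cancel
the obstruction otherwise. The property is an isomorphism invariant: `G` has trivial center, so
isomorphisms of extensions descend to automorphisms of `G`; these preserve the base, and the
infinite stabilizer orbits force some multiple of each coordinate generator to go to a coordinate
generator (`exists_single_eq_map_single`). -/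

namespace GroupVN

/-! ### Unitary roots of unitary operators -/

section UnitaryRoot

open Filter Topology Complex

/-- The branch of the `n`-th root that is discontinuous along the negative real axis,
normalized to have modulus one. -/
noncomputable def circleRoot (n : ℕ) (z : ℂ) : ℂ := cexp ((arg z / n : ℝ) * I)

theorem norm_circleRoot (n : ℕ) (z : ℂ) : ‖circleRoot n z‖ = 1 := norm_exp_ofReal_mul_I _

theorem circleRoot_pow {n : ℕ} (hn : n ≠ 0) {z : ℂ} (hz : ‖z‖ = 1) : circleRoot n z ^ n = z := by
  have hn' : (n : ℂ) ≠ 0 := by exact_mod_cast hn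
  rw [circleRoot, ← exp_nat_mul]
  conv_rhs => rw [← norm_mul_exp_arg_mul_I z, hz]
  push_cast
  rw [← mul_assoc, mul_div_cancel₀ _ hn', one_mul]

theorem mem_slitPlane_of_norm_eq_one {z : ℂ} (hz : ‖z‖ = 1) (h : z ≠ -1) : z ∈ slitPlane := by
  rw [mem_slitPlane_iff_arg]
  refine ⟨fun h' => h ?_, fun h0 => by simp [h0] at hz⟩
  rw [← norm_mul_exp_arg_mul_I z, hz, h']
  simp

/-- A bounded function with a discontinuity at `-1` becomes continuous after multiplication by
a continuous function that vanishes at `-1`. -/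
theorem continuousOn_mul_circleRoot {n : ℕ} {c : ℂ → ℂ} (hc : Continuous c) (h : c (-1) = 0)
    (j : ℕ) (ζ : ℂ) :
    ContinuousOn (fun z => c z * (circleRoot n z ^ j - ζ)) (Metric.sphere 0 1) := by
  intro z hz
  have hz1 : ‖z‖ = 1 := by simpa using hz
  by_cases h1 : z = -1
  · subst h1
    refine ContinuousAt.continuousWithinAt ?_
    rw [ContinuousAt, h, zero_mul]
    refine squeeze_zero_norm (a := fun z => ‖c z‖ * (1 + ‖ζ‖)) (fun z => ?_) ?_
    · rw [norm_mul]
      gcongr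
      refine (norm_sub_le _ _).trans ?_
      rw [norm_pow, norm_circleRoot, one_pow]
    · have : Continuous fun z => ‖c z‖ * (1 + ‖ζ‖) := by fun_prop
      simpa [h] using this.tendsto (-1)
  · have ha : ContinuousAt arg z := continuousAt_arg (mem_slitPlane_of_norm_eq_one hz1 h1)
    unfold circleRoot
    refine ContinuousAt.continuousWithinAt ?_
    fun_prop

variable {H : Type*} [NormedAddCommGroup H] [InnerProductSpace ℂ H]

/-- The usual three-epsilon argument: contractions are equicontinuous, so strong convergence need
only be tested on a dense set. -/
theorem cauchySeq_of_mem_closure {A : ℕ → H →L[ℂ] H} (hA : ∀ k, ‖A k‖ ≤ 1) {x : H}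
    (hx : x ∈ closure {x | CauchySeq fun k => A k x}) : CauchySeq fun k => A k x := by
  rw [Metric.cauchySeq_iff']
  intro ε hε
  obtain ⟨y, hy, hxy⟩ := Metric.mem_closure_iff.1 hx (ε / 3) (by positivity)
  obtain ⟨N, hN⟩ := Metric.cauchySeq_iff'.1 hy (ε / 3) (by positivity)
  refine ⟨N, fun k hk => ?_⟩
  have h (m : ℕ) : dist (A m x) (A m y) ≤ dist x y := by
    rw [dist_eq_norm, dist_eq_norm, ← map_sub]
    exact (A m).le_of_opNorm_le (hA m) _ |>.trans (by rw [one_mul])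
  have h1 := h k
  have h2 := h N
  have h3 := hN k hk
  rw [dist_comm] at h2
  linarith [dist_triangle (A k x) (A k y) (A N x), dist_triangle (A k y) (A N y) (A N x)]

theorem norm_le_of_tendsto_of_norm_le_one {A : ℕ → H →L[ℂ] H} (hA : ∀ k, ‖A k‖ ≤ 1) {W : H →L[ℂ] H}
    (hW : ∀ x, Tendsto (fun k => A k x) atTop (𝓝 (W x))) (x : H) : ‖W x‖ ≤ ‖x‖ :=
  le_of_tendsto (hW x).norm (Eventually.of_forall fun k =>
    ((A k).le_of_opNorm_le (hA k) x).trans (by rw [one_mul]))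

variable [CompleteSpace H]

/-- For normal `U` the orthogonal complement of the range is the kernel. This gives a dense subspace
on which limits of functions of `u` can be computed, with `U = 1 + u`. -/
theorem topologicalClosure_ker_sup_range {U : H →L[ℂ] H} (hU : IsStarNormal U) :
    (U.ker ⊔ U.range).topologicalClosure = ⊤ := by
  rw [Submodule.topologicalClosure_eq_top_iff, ← Submodule.inf_orthogonal,
    ContinuousLinearMap.IsStarNormal.orthogonal_range hU, inf_comm]
  exact Submodule.inf_orthogonal_eq_bot _

/-- Every unitary operator `u` has a unitary `n`-th root in the bicommutant of `{u, u*}`. -/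
theorem exists_unitary_pow_eq {u : H →L[ℂ] H} (hu : u ∈ unitary (H →L[ℂ] H)) {n : ℕ}
    (hn : n ≠ 0) :
    ∃ W ∈ unitary (H →L[ℂ] H), W ^ n = u ∧
      ∀ T : H →L[ℂ] H, Commute u T → Commute (star u) T → Commute W T := by
  have hun : IsStarNormal u := ⟨by
    rw [commute_iff_eq, Unitary.star_mul_self_of_mem hu, Unitary.mul_star_self_of_mem hu]⟩
  have hsp : spectrum ℂ u ⊆ Metric.sphere 0 1 := spectrum.subset_circle_of_unitary hu
  have hsp1 : ∀ z ∈ spectrum ℂ u, ‖z‖ = 1 := fun z hz => by simpa using hsp hz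
  -- The root `f` jumps at `-1`, so continuous functional calculus does not apply to it directly. It
  -- is replaced by continuous `F k` of modulus at most one, equal to `ζ` at `-1`, and `W` is the
  -- strong limit of `F k (u)`.
  set f := circleRoot n with hf
  set ζ := f (-1) with hζ
  have hζ1 : ‖ζ‖ = 1 := norm_circleRoot _ _
  set U : H →L[ℂ] H := 1 + u with hU
  have hUn : IsStarNormal U := ⟨by
    have := hun.star_comm_self
    simp only [hU, star_add, star_one, commute_iff_eq] at this ⊢
    rw [add_mul, mul_add, mul_add, add_mul, mul_add, mul_add, this]
    simp only [one_mul, mul_one]; abel⟩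
  have hUc : U = cfc (fun z : ℂ => 1 + z) u := by
    rw [cfc_const_add (1 : ℂ) (fun z => z) u, cfc_id' ℂ u, map_one]
  -- A regularized inverse of `1 + z`: it vanishes at `-1`, and `(1 + z) * c k z` lies in `[0, 1)`
  -- and tends to `1` elsewhere.
  let c : ℕ → ℂ → ℂ := fun k z =>
    (k + 1) ^ 2 * (starRingEnd ℂ) (1 + z) / ((1 + ((k + 1) * ‖1 + z‖) ^ 2 : ℝ) : ℂ)
  have hden (k : ℕ) (z : ℂ) : ((1 + ((k + 1) * ‖1 + z‖) ^ 2 : ℝ) : ℂ) ≠ 0 := by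
    rw [ofReal_ne_zero]; positivity
  have hc (k : ℕ) : Continuous (c k) := by
    refine Continuous.div ?_ ?_ (hden k)
    · exact continuous_const.mul (continuous_conj.comp (by fun_prop))
    · fun_prop
  have hc1 (k : ℕ) : c k (-1) = 0 := by simp [c]
  have hmul (k : ℕ) (z : ℂ) : (1 + z) * c k z =
      ((((k + 1) * ‖1 + z‖) ^ 2 / (1 + ((k + 1) * ‖1 + z‖) ^ 2) : ℝ) : ℂ) := by
    simp only [c]
    rw [← mul_div_assoc, mul_left_comm, mul_conj, normSq_eq_norm_sq]
    push_cast
    ring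
  have hmul' (k : ℕ) (z : ℂ) : 1 - (1 + z) * c k z =
      ((1 / (1 + ((k + 1) * ‖1 + z‖) ^ 2) : ℝ) : ℂ) := by
    rw [hmul, ← ofReal_one, ← ofReal_sub]
    congr 1
    field_simp
    ring
  let g : ℕ → ℂ → ℂ := fun k z => c k z * (f z - ζ)
  have hg (k : ℕ) : ContinuousOn (g k) (spectrum ℂ u) := by
    simpa using (continuousOn_mul_circleRoot (n := n) (hc k) (hc1 k) 1 ζ).mono hsp
  -- This is the convex combination of `ζ` and `f z` with weight `(1 + z) * c k z` on `f z`, whence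
  -- the bound by one.
  let F : ℕ → ℂ → ℂ := fun k z => ζ + g k z * (1 + z)
  have hF (k : ℕ) : ContinuousOn (F k) (spectrum ℂ u) :=
    continuousOn_const.add ((hg k).mul (by fun_prop))
  have hF1 (k : ℕ) (z : ℂ) : ‖F k z‖ ≤ 1 := by
    have e : F k z = (1 - (1 + z) * c k z) * ζ + ((1 + z) * c k z) * f z := by
      simp only [F, g]; ring
    rw [e, hmul', hmul]
    refine (norm_add_le _ _).trans ?_
    rw [norm_mul, norm_mul, hζ1, hf, norm_circleRoot, norm_real, norm_real,
      Real.norm_of_nonneg (by positivity), Real.norm_of_nonneg (by positivity)]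
    refine le_of_eq ?_
    field_simp
  -- The factor `1 + z` kills the jump of `f ^ j`, so these functions have a continuous functional
  -- calculus and describe `W ^ j` on the range of `U`.
  let h : ℕ → ℂ → ℂ := fun j z => (1 + z) * f z ^ j
  have hh (j : ℕ) : ContinuousOn (h j) (spectrum ℂ u) := by
    simpa using (continuousOn_mul_circleRoot (n := n) (c := fun z => 1 + z) (by fun_prop)
      (by simp) j 0).mono hsp
  let A : ℕ → H →L[ℂ] H := fun k => cfc (F k) u
  have hA (k : ℕ) : ‖A k‖ ≤ 1 := norm_cfc_le zero_le_one fun z _ => hF1 k z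
  have hAker (k : ℕ) (x : H) (hx : U x = 0) : A k x = ζ • x := by
    have e : A k = algebraMap ℂ _ ζ + cfc (g k) u * U := by
      simp only [A, F]
      rw [cfc_const_add ζ (fun z => g k z * (1 + z)) u ((hg k).mul (by fun_prop)),
        cfc_mul (g k) (fun z => 1 + z) u (hg k) (by fun_prop), ← hUc]
    rw [e]
    simp [hx, Algebra.algebraMap_eq_smul_one]
  have hAh (j : ℕ) : Tendsto (fun k => A k * cfc (h j) u) atTop (𝓝 (cfc (h (j + 1)) u)) := by
    rw [tendsto_iff_norm_sub_tendsto_zero]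
    refine squeeze_zero (fun _ => norm_nonneg _) (fun k => ?_)
      (tendsto_one_div_add_atTop_nhds_zero_nat (𝕜 := ℝ))
    simp only [A]
    rw [← cfc_mul (F k) (h j) u (hF k) (hh j),
      ← cfc_sub (fun z => F k z * h j z) (h (j + 1)) u ((hF k).mul (hh j)) (hh (j + 1))]
    refine norm_cfc_le (by positivity) fun z _ => ?_
    have e : F k z * h j z - h (j + 1) z
        = (1 - (1 + z) * c k z) * (1 + z) * ((ζ - f z) * f z ^ j) := by
      simp only [F, g, h]; ring
    rw [e, hmul', norm_mul, norm_mul, norm_mul, norm_pow, hf, norm_circleRoot, one_pow, mul_one,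
      norm_real, Real.norm_of_nonneg (by positivity)]
    have h2 : ‖ζ - circleRoot n z‖ ≤ 2 := by
      refine (norm_sub_le _ _).trans ?_
      rw [hζ1, norm_circleRoot]; norm_num
    -- With `t = (k + 1) * ‖1 + z‖`, the bound is `2 * t ≤ 1 + t ^ 2`.
    calc _ ≤ 1 / (1 + ((k + 1 : ℝ) * ‖1 + z‖) ^ 2) * ‖1 + z‖ * 2 := by gcongr
      _ ≤ _ := by
        rw [one_div_mul_eq_div, div_mul_eq_mul_div, div_le_div_iff₀ (by positivity) (by positivity)]
        nlinarith [sq_nonneg ((k + 1 : ℝ) * ‖1 + z‖ - 1)]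
  have hh0 : cfc (h 0) u = U := by simp [h, hUc]
  have hAr (j : ℕ) (y : H) : Tendsto (fun k => A k (cfc (h j) u y)) atTop
      (𝓝 (cfc (h (j + 1)) u y)) :=
    ((ContinuousLinearMap.apply ℂ H y).continuous.tendsto _).comp (hAh j)
  have hcau (x : H) : CauchySeq fun k => A k x := by
    refine cauchySeq_of_mem_closure hA ?_
    have hx : x ∈ (U.ker ⊔ U.range).topologicalClosure := by
      rw [topologicalClosure_ker_sup_range hUn]; trivial
    refine closure_mono ?_ hx
    intro y hy
    obtain ⟨a, ha, b, ⟨b', hb⟩, rfl⟩ := Submodule.mem_sup.1 hy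
    have ha' : U a = 0 := ha
    have hb' : U b' = b := hb
    have h1 : Tendsto (fun k => A k (a + b)) atTop (𝓝 (ζ • a + cfc (h 1) u b')) := by
      simp only [map_add, hAker _ _ ha']
      refine tendsto_const_nhds.add ?_
      rw [← hb', ← hh0]
      exact hAr 0 b'
    exact h1.cauchySeq
  choose w hw using fun x => cauchySeq_tendsto_of_complete (hcau x)
  let W : H →L[ℂ] H := continuousLinearMapOfTendsto A (f := w) (tendsto_pi_nhds.2 hw)
  have hW (x : H) : Tendsto (fun k => A k x) atTop (𝓝 (W x)) := hw x
  have hWle (x : H) : ‖W x‖ ≤ ‖x‖ := norm_le_of_tendsto_of_norm_le_one hA hW x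
  have hWker (x : H) (hx : U x = 0) : W x = ζ • x :=
    tendsto_nhds_unique (hW x) (by simp only [hAker _ _ hx]; exact tendsto_const_nhds)
  have hWh (j : ℕ) (y : H) : W (cfc (h j) u y) = cfc (h (j + 1)) u y :=
    tendsto_nhds_unique (hW _) (hAr j y)
  have hWpow (j : ℕ) (y : H) : (W ^ j) (U y) = cfc (h j) u y := by
    induction j with
    | zero => rw [hh0]; rfl
    | succ j ih => rw [pow_succ', mul_apply_eq_comp, ih, hWh]
  have hWn : W ^ n = u := by
    -- On the kernel of `U` the operator `u` is `-1` and `W` is `ζ` with `ζ ^ n = -1`; on the range,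
    -- `W ^ n` acts through `h n = (1 + z) * z`.
    have hle : U.ker ⊔ U.range ≤ (W ^ n - u).ker := by
      refine sup_le (fun x hx => ?_) ?_
      · have hx' : U x = 0 := hx
        have hp (j : ℕ) : (W ^ j) x = ζ ^ j • x := by
          induction j with
          | zero => simp
          | succ j ih =>
            rw [pow_succ', mul_apply_eq_comp, ih, map_smul, hWker x hx', smul_smul,
              pow_succ]
        have hux : u x = -x := by
          have : x + u x = 0 := hx'
          exact (neg_eq_of_add_eq_zero_right this).symm
        change (W ^ n - u) x = 0
        rw [sub_apply, hp, hζ, hf, circleRoot_pow hn (by simp), hux]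
        simp
      · rintro _ ⟨y, rfl⟩
        change (W ^ n - u) (U y) = 0
        rw [sub_apply, hWpow, sub_eq_zero, ← mul_apply_eq_comp]
        congr 1
        have : u * U = cfc (fun z : ℂ => z * (1 + z)) u := by
          rw [cfc_mul (fun z : ℂ => z) (fun z => 1 + z) u, cfc_id' ℂ u, hUc]
        rw [this]
        refine cfc_congr fun z hz => ?_
        simp only [h]
        rw [hf, circleRoot_pow hn (hsp1 z hz), mul_comm]
    have htop : (W ^ n - u).ker = ⊤ := by
      rw [eq_top_iff, ← topologicalClosure_ker_sup_range hUn]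
      exact Submodule.topologicalClosure_minimal _ hle (W ^ n - u).isClosed_ker
    rw [← sub_eq_zero]
    ext x
    have : x ∈ (W ^ n - u).ker := by rw [htop]; trivial
    exact this
  have hpowle (j : ℕ) (x : H) : ‖(W ^ j) x‖ ≤ ‖x‖ := by
    induction j with
    | zero => simp
    | succ j ih => rw [pow_succ']; exact (hWle _).trans ih
  obtain ⟨m, rfl⟩ := Nat.exists_eq_succ_of_ne_zero hn
  -- A contraction with an isometric power is itself isometric.
  have hnorm (x : H) : ‖W x‖ = ‖x‖ := by
    refine le_antisymm (hWle x) ?_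
    have h1 : ‖u x‖ = ‖x‖ := ContinuousLinearMap.norm_map_of_mem_unitary hu x
    rw [← h1, ← hWn, pow_succ]
    exact hpowle m (W x)
  have hstar : star W * W = 1 := (ContinuousLinearMap.norm_map_iff_adjoint_comp_self W).1 hnorm
  have hright : W * (W ^ m * star u) = 1 := by
    rw [← mul_assoc, ← pow_succ', hWn, Unitary.mul_star_self_of_mem hu]
  refine ⟨W, ⟨hstar, ?_⟩, hWn, fun T h1 h2 => ?_⟩
  · rw [left_inv_eq_right_inv hstar hright, hright]
  · ext x
    refine tendsto_nhds_unique (hW (T x)) ?_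
    have h3 (k : ℕ) : A k (T x) = T (A k x) :=
      congrArg (fun S : H →L[ℂ] H => S x) (Commute.cfc h1 h2 (F k)).eq
    simp only [h3]
    exact (T.continuous.tendsto _).comp (hW x)

end UnitaryRoot

/-! ### Spatial isomorphisms of generated von Neumann algebras -/

section GeneratedVN

variable {H K : Type*} [NormedAddCommGroup H] [InnerProductSpace ℂ H] [CompleteSpace H]
  [NormedAddCommGroup K] [InnerProductSpace ℂ K] [CompleteSpace K]

theorem mem_generatedVN_iff {S : Set (H →L[ℂ] H)} {T : H →L[ℂ] H} :
    T ∈ (generatedVN S).toStarSubalgebra ↔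
      ∀ y : H →L[ℂ] H, (∀ s ∈ S, Commute s y ∧ Commute (star s) y) → Commute T y := by
  refine (StarSubalgebra.mem_centralizer_iff ℂ).trans ?_
  constructor
  · intro h y hy
    exact (h y ((StarSubalgebra.mem_centralizer_iff ℂ).2 fun s hs => hy s hs)).1.symm
  · intro h y hy
    have hy' := (StarSubalgebra.mem_centralizer_iff ℂ).1 hy
    have hy'' := (StarSubalgebra.mem_centralizer_iff ℂ).1 (star_mem hy)
    exact ⟨(h y fun s hs => hy' s hs).symm, (h (star y) fun s hs => hy'' s hs).symm⟩

theorem subset_generatedVN {S : Set (H →L[ℂ] H)} {s : H →L[ℂ] H} (hs : s ∈ S) :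
    s ∈ (generatedVN S).toStarSubalgebra :=
  mem_generatedVN_iff.2 fun _ hy => (hy s hs).1

/-- A `*`-isomorphism of the full operator algebras respects commutation, so pulling an element of
the target commutant back along `φ` lands in the commutant of `S`. Only generators then need
checking. -/
theorem map_mem_generatedVN (φ : (H →L[ℂ] H) ≃⋆ₐ[ℂ] (K →L[ℂ] K)) {S : Set (H →L[ℂ] H)}
    {S' : Set (K →L[ℂ] K)} (h : ∀ s ∈ S, φ s ∈ (generatedVN S').toStarSubalgebra)
    {T : H →L[ℂ] H} (hT : T ∈ (generatedVN S).toStarSubalgebra) :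
    φ T ∈ (generatedVN S').toStarSubalgebra := by
  rw [mem_generatedVN_iff] at hT ⊢
  intro y hy
  have key : ∀ s, φ s ∈ (generatedVN S').toStarSubalgebra → Commute s (φ.symm y) := by
    intro s hs
    have := mem_generatedVN_iff.1 hs y hy
    rw [commute_iff_eq] at this ⊢
    apply EquivLike.injective φ
    rw [map_mul, map_mul, φ.apply_symm_apply, this]
  have h1 := hT (φ.symm y) fun s hs => ⟨key s (h s hs), key (star s) (by
    have e : φ (star s) = star (φ s) := φ.map_star' s
    rw [e]; exact star_mem (h s hs))⟩
  rw [commute_iff_eq] at h1 ⊢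
  rw [← φ.apply_symm_apply y, ← map_mul, h1, map_mul]

theorem nonempty_starAlgEquiv_generatedVN (φ : (H →L[ℂ] H) ≃⋆ₐ[ℂ] (K →L[ℂ] K))
    {S : Set (H →L[ℂ] H)} {S' : Set (K →L[ℂ] K)}
    (h : ∀ s ∈ S, φ s ∈ (generatedVN S').toStarSubalgebra)
    (h' : ∀ s ∈ S', φ.symm s ∈ (generatedVN S).toStarSubalgebra) :
    Nonempty ((generatedVN S).toStarSubalgebra ≃⋆ₐ[ℂ] (generatedVN S').toStarSubalgebra) :=
  ⟨{ toFun := fun x => ⟨φ x.1, map_mem_generatedVN φ h x.2⟩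
     invFun := fun x => ⟨φ.symm x.1, map_mem_generatedVN φ.symm h' x.2⟩
     left_inv := fun x => Subtype.ext (φ.symm_apply_apply x.1)
     right_inv := fun x => Subtype.ext (φ.apply_symm_apply x.1)
     map_mul' := fun x y => Subtype.ext (map_mul φ x.1 y.1)
     map_add' := fun x y => Subtype.ext (map_add φ x.1 y.1)
     map_star' := fun x => Subtype.ext (φ.map_star' x.1)
     map_smul' := fun r x => Subtype.ext (map_smul φ r x.1) }⟩

end GeneratedVN

/-! ### Permutation unitaries and coordinate projections on `ℓ²` -/

section SequenceSpace

variable {X Y : Type*}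

theorem memlp_comp_equiv (e : X ≃ Y) (f : EllTwo X) : Memℓp (fun y : Y => f (e.symm y)) 2 := by
  have hp : 0 < (2 : ℝ≥0∞).toReal := by norm_num
  exact memℓp_gen (((lp.memℓp f).summable hp).comp_injective e.symm.injective)

/-- The unitary between sequence spaces induced by a bijection of the index sets. -/
noncomputable def permIso (e : X ≃ Y) : EllTwo X ≃ₗᵢ[ℂ] EllTwo Y where
  toFun f := ⟨fun y => f (e.symm y), memlp_comp_equiv e f⟩
  invFun f := ⟨fun x => f (e x), memlp_comp_equiv e.symm f⟩
  left_inv f := by ext x; exact congrArg f (e.symm_apply_apply x)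
  right_inv f := by ext x; exact congrArg f (e.apply_symm_apply x)
  map_add' _ _ := rfl
  map_smul' _ _ := rfl
  norm_map' f := by
    have hp : 0 < (2 : ℝ≥0∞).toReal := by norm_num
    rw [lp.norm_eq_tsum_rpow hp, lp.norm_eq_tsum_rpow hp]
    congr 1
    exact e.symm.tsum_eq (fun x : X => ‖f x‖ ^ (2 : ℝ≥0∞).toReal)

theorem permIso_apply (e : X ≃ Y) (f : EllTwo X) (y : Y) : permIso e f y = f (e.symm y) := rfl

open Classical in
/-- The standard basis vector of `ℓ²(X)` at a point. -/
noncomputable def stdVec (x : X) : EllTwo X := lp.single 2 x (1 : ℂ)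

open Classical in
theorem stdVec_apply (x y : X) : stdVec x y = if y = x then 1 else 0 := by
  rw [stdVec, lp.single_apply, Pi.single_apply]

theorem permIso_stdVec (e : X ≃ Y) (x : X) : permIso e (stdVec x) = stdVec (e x) := by
  classical
  ext y
  rw [permIso_apply, stdVec_apply, stdVec_apply]
  simp only [Equiv.symm_apply_eq]

theorem clm_ext_stdVec {K : Type*} [NormedAddCommGroup K] [NormedSpace ℂ K]
    {S T : EllTwo X →L[ℂ] K} (h : ∀ x, S (stdVec x) = T (stdVec x)) : S = T := by
  classical
  have hp : (2 : ℝ≥0∞) ≠ ⊤ := by norm_num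
  ext f
  have hf := lp.hasSum_single hp f
  refine (hf.map S S.continuous).unique ?_
  convert hf.map T T.continuous using 1
  funext x
  have : lp.single 2 x (f x) = f x • stdVec x := by
    rw [stdVec, ← lp.single_smul]; simp
  simp only [Function.comp_apply, this, map_smul, h]

theorem memlp_indicator (S : Set X) (f : EllTwo X) : Memℓp (S.indicator f) 2 :=
  (lp.memℓp f).mono' fun _ => norm_indicator_le_norm_self _ _

/-- The orthogonal projection of `ℓ²(X)` onto `ℓ²(S)`. -/
noncomputable def maskOp (S : Set X) : EllTwo X →L[ℂ] EllTwo X :=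
  LinearMap.mkContinuous
    { toFun := fun f => ⟨S.indicator f, memlp_indicator S f⟩
      map_add' := fun f g => by
        ext x; exact congrFun (Set.indicator_add S f g) x
      map_smul' := fun c f => by
        ext x; exact congrFun (Set.indicator_const_smul S c f) x } 1
    fun f => by
      rw [one_mul]
      exact lp.norm_mono (by norm_num) fun x => norm_indicator_le_norm_self _ _

theorem maskOp_apply (S : Set X) (f : EllTwo X) (x : X) : maskOp S f x = S.indicator f x := rfl

theorem maskOp_stdVec_of_mem {S : Set X} {x : X} (hx : x ∈ S) :
    maskOp S (stdVec x) = stdVec x := by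
  classical
  ext y
  rw [maskOp_apply, Set.indicator_apply, stdVec_apply]
  split_ifs <;> simp_all

theorem maskOp_stdVec_of_notMem {S : Set X} {x : X} (hx : x ∉ S) :
    maskOp S (stdVec x) = 0 := by
  classical
  ext y
  rw [maskOp_apply, Set.indicator_apply, stdVec_apply]
  split_ifs <;> simp_all

theorem star_maskOp (S : Set X) : star (maskOp S) = maskOp S := by
  classical
  symm
  rw [ContinuousLinearMap.star_eq_adjoint, ContinuousLinearMap.eq_adjoint_iff]
  intro f g
  rw [lp.inner_eq_tsum, lp.inner_eq_tsum]
  refine tsum_congr fun x => ?_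
  rw [maskOp_apply, maskOp_apply, Set.indicator_apply, Set.indicator_apply]
  split_ifs <;> simp

end SequenceSpace

/-- A block-diagonal element with unitary blocks: orthogonality of the `P k` kills the cross terms.
It is applied to the powers of the root `W`. -/
theorem sum_mul_mem_unitary {R ι : Type*} [Ring R] [StarRing R] [Fintype ι] [DecidableEq ι]
    {a P : ι → R} (ha : ∀ k, a k ∈ unitary R) (hP : ∀ k, star (P k) = P k)
    (hPP : ∀ k l, P k * P l = if k = l then P k else 0) (hP1 : ∑ k, P k = 1)
    (hc : ∀ k l, Commute (a k) (P l)) : ∑ k, a k * P k ∈ unitary R := by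
  have hc' (k l) : Commute (star (a k)) (P l) := by
    have := (hc k l).star_star
    rwa [hP] at this
  have hs : star (∑ k, a k * P k) = ∑ k, P k * star (a k) := by
    rw [star_sum]
    simp only [star_mul, hP]
  rw [Unitary.mem_iff, hs, Finset.sum_mul_sum, Finset.sum_mul_sum]
  constructor
  · rw [← hP1]
    refine Finset.sum_congr rfl fun k _ => ?_
    rw [Finset.sum_eq_single k]
    · rw [mul_assoc, ← mul_assoc (star (a k)), Unitary.star_mul_self_of_mem (ha k), one_mul,
        hPP, if_pos rfl]
    · intro l _ hl
      rw [← (hc' k k).eq, mul_assoc, ← mul_assoc (P k), ← (hc l k).eq, mul_assoc (a l), hPP,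
        if_neg hl.symm, mul_zero, mul_zero]
    · simp
  · rw [← hP1]
    refine Finset.sum_congr rfl fun k _ => ?_
    rw [Finset.sum_eq_single k]
    · rw [mul_assoc, ← mul_assoc (P k), hPP, if_pos rfl, ← (hc' k k).eq, ← mul_assoc,
        Unitary.mul_star_self_of_mem (ha k), one_mul]
    · intro l _ hl
      rw [mul_assoc, ← mul_assoc (P k), hPP, if_neg hl.symm, zero_mul, mul_zero]
    · simp

/-! ### The left regular representation -/

section Regular

variable {G Λ : Type*} [Group G] [Group Λ]

theorem lam_stdVec (g h : G) : lam g (stdVec h) = stdVec (g * h) :=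
  permIso_stdVec (Equiv.mulLeft g) h

theorem lam_mul (g h : G) : lam g * lam h = lam (g * h) :=
  clm_ext_stdVec fun x => by
    rw [mul_apply_eq_comp, lam_stdVec, lam_stdVec, lam_stdVec, mul_assoc]

theorem lam_one : lam (1 : G) = 1 :=
  clm_ext_stdVec fun x => by rw [lam_stdVec, one_mul]; rfl

theorem star_lam (g : G) : star (lam g) = lam g⁻¹ := by
  have h1 : star (lam g) * lam g = 1 :=
    (ContinuousLinearMap.norm_map_iff_adjoint_comp_self (lam g)).1
      (permIso (Equiv.mulLeft g)).norm_map
  have h2 : lam g * lam g⁻¹ = 1 := by rw [lam_mul, mul_inv_cancel, lam_one]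
  exact left_inv_eq_right_inv h1 h2

theorem lam_mem_unitary (g : G) : lam g ∈ unitary (EllTwo G →L[ℂ] EllTwo G) := by
  rw [Unitary.mem_iff, star_lam, lam_mul, lam_mul, inv_mul_cancel, mul_inv_cancel, lam_one]
  exact ⟨rfl, rfl⟩

theorem lam_commute_of_central {c : G} (hc : c ∈ Subgroup.center G) (g : G) :
    Commute (lam c) (lam g) := by
  rw [commute_iff_eq, lam_mul, lam_mul, Subgroup.mem_center_iff.1 hc g]

/-- The generators are closed under adjoints, so the adjoint conditions in the commutant are
automatic. -/
theorem mem_groupVN_iff {T : EllTwo G →L[ℂ] EllTwo G} :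
    T ∈ (groupVN G).toStarSubalgebra ↔
      ∀ y : EllTwo G →L[ℂ] EllTwo G, (∀ g, Commute (lam g) y) → Commute T y := by
  refine mem_generatedVN_iff.trans (forall_congr' fun y => imp_congr_left ?_)
  rw [Set.forall_mem_range]
  exact ⟨fun h g => (h g).1, fun h g => ⟨h g, star_lam g ▸ h g⁻¹⟩⟩

theorem GroupVNIso.symm (h : GroupVNIso G Λ) : GroupVNIso Λ G :=
  h.map StarAlgEquiv.symm

theorem GroupVNIso.trans {Λ' : Type*} [Group Λ'] (h : GroupVNIso G Λ) (h' : GroupVNIso Λ Λ') :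
    GroupVNIso G Λ' :=
  h.elim fun a => h'.elim fun b => ⟨a.trans b⟩

theorem GroupVNIso.of_mulEquiv (e : G ≃* Λ) : GroupVNIso G Λ := by
  refine nonempty_starAlgEquiv_generatedVN (permIso e.toEquiv).conjStarAlgEquiv ?_ ?_
  · rintro _ ⟨g, rfl⟩
    refine subset_generatedVN ⟨e g, clm_ext_stdVec fun x => ?_⟩
    obtain ⟨x, rfl⟩ := e.surjective x
    have : (permIso e.toEquiv).symm (stdVec (e x)) = stdVec x := by
      rw [LinearIsometryEquiv.symm_apply_eq]; exact (permIso_stdVec e.toEquiv x).symm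
    rw [LinearIsometryEquiv.conjStarAlgEquiv_apply_apply, this, lam_stdVec, lam_stdVec,
      permIso_stdVec, ← map_mul]
    rfl
  · rintro _ ⟨g, rfl⟩
    obtain ⟨g, rfl⟩ := e.surjective g
    refine subset_generatedVN ⟨g, clm_ext_stdVec fun x => ?_⟩
    rw [LinearIsometryEquiv.symm_conjStarAlgEquiv_apply_apply, permIso_stdVec]
    change _ = (permIso e.toEquiv).symm (lam (e g) (stdVec (e x)))
    rw [lam_stdVec, lam_stdVec, ← map_mul, eq_comm, LinearIsometryEquiv.symm_apply_eq]
    exact (permIso_stdVec e.toEquiv _).symm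

end Regular

theorem CocycleExt.mul_def {G C : Type*} [Group G] [AddCommGroup C] {z : Z2 G C}
    (x y : CocycleExt z) :
    x * y = ⟨x.left + y.left + z.1 x.right y.right, x.right * y.right⟩ := rfl

theorem CocycleExt.one_def {G C : Type*} [Group G] [AddCommGroup C] {z : Z2 G C} :
    (1 : CocycleExt z) = ⟨0, 1⟩ := rfl

theorem CocycleExt.mem_center_of_right_eq_one {G C : Type*} [Group G] [AddCommGroup C]
    {z : Z2 G C} {x : CocycleExt z} (hx : x.right = 1) : x ∈ Subgroup.center (CocycleExt z) := by
  rw [Subgroup.mem_center_iff]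
  intro y
  simp only [CocycleExt.mul_def, hx, (z.2.2 y.right).1, (z.2.2 y.right).2, mul_one, one_mul,
    add_comm y.left]

/-! ### Carry cocycles do not change the von Neumann algebra -/

section Carry

variable {G C : Type*} [Group G] [AddCommGroup C] {n : ℕ} [NeZero n]

theorem val_add_val_eq (a b : ZMod n) :
    a.val + b.val = (a + b).val + n * ((a.val + b.val) / n) := by
  rw [ZMod.val_add, Nat.mod_add_div]

/-- The coordinate identification of two cocycle extensions. -/
def CocycleExt.coordEquiv (z z' : Z2 G C) : CocycleExt z ≃ CocycleExt z' where
  toFun x := ⟨x.left, x.right⟩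
  invFun x := ⟨x.left, x.right⟩
  left_inv _ := rfl
  right_inv _ := rfl

/-- Changing a cocycle by the inflation of a carry cocycle on `ℤ/nℤ` does not change the group
von Neumann algebra of the central extension. -/
theorem groupVNIso_of_carry (z z' : Z2 G C) (c₀ : C) (s : G → ZMod n)
    (hs : ∀ g h, s (g * h) = s g + s h)
    (hz : ∀ g h, z'.1 g h = z.1 g h + (((s g).val + (s h).val) / n) • c₀) :
    GroupVNIso (CocycleExt z') (CocycleExt z) := by
  classical
  have hs1 : s 1 = 0 := by simpa using hs 1 1
  set t : CocycleExt z := ⟨c₀, 1⟩ with ht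
  have htc : t ∈ Subgroup.center (CocycleExt z) := CocycleExt.mem_center_of_right_eq_one rfl
  have htpow (k : ℕ) (x : CocycleExt z) : t ^ k * x = ⟨k • c₀ + x.left, x.right⟩ := by
    induction k with
    | zero => simp
    | succ k ih =>
      rw [pow_succ', mul_assoc, ih, CocycleExt.mul_def]
      simp only [ht, (z.2.2 x.right).2, add_zero, one_mul, succ_nsmul', add_assoc]
  obtain ⟨W, hW, hWn, hWc⟩ := exists_unitary_pow_eq (lam_mem_unitary t) (NeZero.ne n)
  have hWlam (x : CocycleExt z) : Commute W (lam x) :=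
    hWc _ (lam_commute_of_central htc x) (by
      rw [star_lam]; exact lam_commute_of_central (inv_mem htc) x)
  have hlampow (k : ℕ) : lam t ^ k = lam (t ^ k) := by
    induction k with
    | zero => rw [pow_zero, pow_zero, lam_one]
    | succ k ih => rw [pow_succ, pow_succ, ih, lam_mul]
  let A : ZMod n → Set (CocycleExt z) := fun k => {x | s x.right = k}
  let P : ZMod n → EllTwo (CocycleExt z) →L[ℂ] EllTwo (CocycleExt z) := fun k => maskOp (A k)
  have hP (k : ZMod n) (x : CocycleExt z) :
      P k (stdVec x) = if s x.right = k then stdVec x else 0 := by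
    split_ifs with h
    · exact maskOp_stdVec_of_mem h
    · exact maskOp_stdVec_of_notMem h
  have htA (r : CocycleExt z) (hr : r.right = 1) (k : ZMod n) : Commute (lam r) (P k) := by
    refine clm_ext_stdVec fun x => ?_
    rw [mul_apply_eq_comp, mul_apply_eq_comp, lam_stdVec, hP, hP, CocycleExt.mul_def, hr, one_mul]
    split_ifs
    · rw [lam_stdVec, CocycleExt.mul_def, hr, one_mul]
    · rw [map_zero]
  have hWP (k : ZMod n) : Commute W (P k) := hWc _ (htA t rfl k) (by
    rw [star_lam]; exact htA t⁻¹ (inv_one (G := G)) k)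
  -- `V` sends the basis vector at `x` to its image under `W ^ s(x)`; it is the unitary that
  -- implements the twist.
  let V : EllTwo (CocycleExt z) →L[ℂ] EllTwo (CocycleExt z) := ∑ k, W ^ k.val * P k
  have hV : V ∈ unitary (EllTwo (CocycleExt z) →L[ℂ] EllTwo (CocycleExt z)) := by
    refine sum_mul_mem_unitary (fun k => pow_mem hW _) (fun k => star_maskOp _) (fun k l => ?_) ?_
      (fun k l => (hWP l).pow_left _)
    · refine clm_ext_stdVec fun x => ?_
      rw [mul_apply_eq_comp, hP]
      split_ifs with h1 h2 h2
      · rw [hP]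
      · rw [hP, if_neg fun h => h2 (h.symm.trans h1), zero_apply]
      · rw [map_zero, hP, if_neg fun h => h1 (h.trans h2)]
      · rw [map_zero, zero_apply]
    · refine clm_ext_stdVec fun x => ?_
      rw [sum_apply]
      simp only [hP]
      rw [Finset.sum_ite_eq, if_pos (Finset.mem_univ _)]
      rfl
  have hVvec (x : CocycleExt z) : V (stdVec x) = (W ^ (s x.right).val) (stdVec x) := by
    simp only [V]
    rw [sum_apply]
    simp only [mul_apply_eq_comp, hP]
    rw [Finset.sum_eq_single (s x.right)]
    · rw [if_pos rfl]
    · intro k _ hk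
      rw [if_neg hk.symm, map_zero]
    · simp
  let e := CocycleExt.coordEquiv z' z
  let Φ : EllTwo (CocycleExt z') ≃ₗᵢ[ℂ] EllTwo (CocycleExt z) :=
    (permIso e).trans (Unitary.linearIsometryEquiv ⟨V, hV⟩)
  have hΦ (f : EllTwo (CocycleExt z')) : Φ f = V (permIso e f) := rfl
  have key (x : CocycleExt z') :
      Φ.conjStarAlgEquiv (lam x) = W ^ (s x.right).val * lam (e x) := by
    have h1 : ∀ y : CocycleExt z', Φ (lam x (stdVec y)) =
        (W ^ (s x.right).val * lam (e x)) (Φ (stdVec y)) := by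
      intro y
      rw [lam_stdVec, hΦ, hΦ, permIso_stdVec, permIso_stdVec, hVvec, hVvec]
      -- The two products differ by the carry power of `t`. Since `λ_t = W ^ n`, this power
      -- compensates exactly for reducing `s(x) + s(y)` modulo `n`.
      have h2 : e (x * y) = t ^ (((s x.right).val + (s y.right).val) / n) * (e x * e y) := by
        rw [htpow]
        refine CocycleExt.ext ?_ rfl
        change x.left + y.left + z'.1 x.right y.right =
          _ + (x.left + y.left + z.1 x.right y.right)
        rw [hz]; abel
      have h3 : (s (e (x * y)).right).val +
          n * (((s x.right).val + (s y.right).val) / n) =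
          (s x.right).val + (s (e y).right).val := by
        change (s (x.right * y.right)).val + _ = (s x.right).val + (s y.right).val
        rw [hs, ← val_add_val_eq]
      rw [h2] at h3 ⊢
      rw [← lam_stdVec, ← hlampow, ← hWn, ← pow_mul, ← mul_apply_eq_comp, ← pow_add, h3,
        ← lam_stdVec, mul_apply_eq_comp, pow_add, mul_apply_eq_comp]
      congr 1
      rw [← mul_apply_eq_comp, ← mul_apply_eq_comp, ((hWlam (e x)).pow_left _).eq]
    have h4 : (Φ.conjStarAlgEquiv (lam x)).comp (Φ : EllTwo (CocycleExt z') →L[ℂ] _) =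
        (W ^ (s x.right).val * lam (e x)).comp (Φ : EllTwo (CocycleExt z') →L[ℂ] _) := by
      refine clm_ext_stdVec fun y => ?_
      change Φ (lam x (Φ.symm (Φ (stdVec y)))) = _
      rw [LinearIsometryEquiv.symm_apply_apply]
      exact h1 y
    ext1 f
    obtain ⟨f, rfl⟩ := Φ.surjective f
    exact congrArg (fun S : EllTwo (CocycleExt z') →L[ℂ] EllTwo (CocycleExt z) => S f) h4
  have hunit (k : ℕ) : IsUnit (W ^ k) :=
    ⟨Unitary.toUnits ⟨W ^ k, pow_mem hW k⟩, rfl⟩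
  refine nonempty_starAlgEquiv_generatedVN Φ.conjStarAlgEquiv ?_ ?_
  · rintro _ ⟨x, rfl⟩
    rw [key]
    change _ ∈ (groupVN _).toStarSubalgebra
    rw [mem_groupVN_iff]
    intro y hy
    exact ((hWc y (hy t) (star_lam t ▸ hy t⁻¹)).pow_left _).mul_left (hy _)
  · rintro _ ⟨x, rfl⟩
    change _ ∈ (groupVN _).toStarSubalgebra
    rw [mem_groupVN_iff]
    intro y hy
    have hy1 (w : CocycleExt z') :
        Commute (W ^ (s w.right).val * lam (e w)) (Φ.conjStarAlgEquiv y) := by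
      rw [← key, commute_iff_eq, ← map_mul, ← map_mul, (hy w).eq]
    -- The twist is trivial on elements over the identity, so `λ_t`, and with it `W`, is generated
    -- by the images. The factor `W ^ s(x)` can then be cancelled.
    have hy2 (r : CocycleExt z) (hr : r.right = 1) : Commute (lam r) (Φ.conjStarAlgEquiv y) := by
      have := hy1 (e.symm r)
      have h0 : s (e.symm r).right = 0 := by
        change s r.right = 0
        rw [hr, hs1]
      rwa [h0, ZMod.val_zero, pow_zero, one_mul, Equiv.apply_symm_apply] at this
    have hWy : Commute W (Φ.conjStarAlgEquiv y) :=
      hWc _ (hy2 t rfl) (by rw [star_lam]; exact hy2 t⁻¹ (inv_one (G := G)))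
    have hfin : Commute (lam x) (Φ.conjStarAlgEquiv y) := by
      have h1 := hy1 (e.symm x)
      rw [Equiv.apply_symm_apply, commute_iff_eq, mul_assoc, ← mul_assoc _ (W ^ _),
        ← (hWy.pow_left _).eq, mul_assoc] at h1
      exact (hunit _).mul_left_cancel h1
    rw [commute_iff_eq] at hfin ⊢
    apply EquivLike.injective Φ.conjStarAlgEquiv
    rw [map_mul, map_mul, StarAlgEquiv.apply_symm_apply, hfin]

end Carry

/-! ### Automorphisms of the generalized wreath product -/

section WreathAut

open SemidirectProduct Multiplicative

variable {A Γ I : Type*} [AddCommGroup A] [Group Γ] [MulAction Γ I]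

/-- The inclusion of the coordinates into the generalized wreath product. -/
noncomputable def wreathInl (Γ : Type*) [Group Γ] [MulAction Γ I] (a : I →₀ A) :
    GenWreath A Γ I := inl (ofAdd a)

theorem wreathInl_left (a : I →₀ A) : (wreathInl Γ a).left = ofAdd a := rfl

theorem wreathInl_add (a b : I →₀ A) :
    wreathInl Γ (a + b) = wreathInl Γ a * wreathInl Γ b :=
  map_mul inl (ofAdd a) (ofAdd b)

theorem wreathInl_zero : wreathInl Γ (0 : I →₀ A) = 1 := rfl

theorem wreathInl_nsmul (m : ℕ) (a : I →₀ A) : wreathInl Γ (m • a) = wreathInl Γ a ^ m :=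
  map_pow inl (ofAdd a) m

theorem wreathInl_injective : Function.Injective (wreathInl Γ : (I →₀ A) → GenWreath A Γ I) :=
  fun _ _ h => congrArg SemidirectProduct.left h

theorem eq_wreathInl {g : GenWreath A Γ I} (hg : g.right = 1) :
    g = wreathInl Γ g.left.toAdd := SemidirectProduct.ext rfl hg

/-- The action of `Γ` on `A^{(I)}`, written additively. -/
noncomputable def wreathAct (γ : Γ) (a : I →₀ A) : I →₀ A :=
  (wreathAction A Γ I γ (ofAdd a)).toAdd

theorem wreathAct_apply (γ : Γ) (a : I →₀ A) (i : I) : wreathAct γ a i = a (γ⁻¹ • i) := rfl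

theorem wreathAct_apply_smul (γ : Γ) (a : I →₀ A) (i : I) : wreathAct γ a (γ • i) = a i := by
  rw [wreathAct_apply, inv_smul_smul]

theorem wreathAct_single (γ : Γ) (i : I) (a : A) :
    wreathAct γ (Finsupp.single i a) = Finsupp.single (γ • i) a := by
  classical
  ext j
  rw [wreathAct_apply, Finsupp.single_apply, Finsupp.single_apply]
  simp only [eq_inv_smul_iff]

theorem mul_wreathInl (g : GenWreath A Γ I) (a : I →₀ A) :
    g * wreathInl Γ a = wreathInl Γ (wreathAct g.right a) * g := by
  refine SemidirectProduct.ext ?_ ?_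
  · change g.left * ofAdd (wreathAct g.right a) =
      ofAdd (wreathAct g.right a) * (wreathAction A Γ I 1) g.left
    rw [map_one, MulAut.one_apply, mul_comm]
  · change g.right * 1 = 1 * g.right
    rw [mul_one, one_mul]

theorem wreathAct_eq_of_commute {g : GenWreath A Γ I} {a : I →₀ A}
    (h : Commute g (wreathInl Γ a)) : wreathAct g.right a = a := by
  rw [commute_iff_eq, mul_wreathInl] at h
  exact wreathInl_injective (mul_right_cancel h)

variable (hinf : ∀ i j : I, i ≠ j → (MulAction.orbit (MulAction.stabilizer Γ i) j).Infinite)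

include hinf

/-- Every abelian normal subgroup of the generalized wreath product is contained in the base. -/
theorem right_eq_one_of_mem_normal [Nontrivial A] [FaithfulSMul Γ I]
    {K : Subgroup (GenWreath A Γ I)} (hK : K.Normal) (hab : ∀ x ∈ K, ∀ y ∈ K, Commute x y)
    {k : GenWreath A Γ I} (hk : k ∈ K) : k.right = 1 := by
  classical
  obtain ⟨a, ha⟩ := exists_ne (0 : A)
  by_contra hne
  obtain ⟨i, hi⟩ : ∃ i : I, k.right • i ≠ i := by
    by_contra! h
    exact hne (eq_of_smul_eq_smul (α := I) fun i => by rw [h, one_smul])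
  -- This is the commutator of a base element with `k`. Elements of `K` commute with it, so they
  -- move `i` within its support `{i, k • i}`; conjugating `k` by the stabilizer of `i` would then
  -- make the orbit of `k • i` finite.
  set v : I →₀ A := Finsupp.single i a - Finsupp.single (k.right • i) a with hv
  have hvK : wreathInl Γ v ∈ K := by
    have h1 : wreathInl Γ v = wreathInl Γ (Finsupp.single i a) * k *
        (wreathInl Γ (Finsupp.single i a))⁻¹ * k⁻¹ := by
      rw [eq_mul_inv_iff_mul_eq, eq_mul_inv_iff_mul_eq, mul_assoc, mul_wreathInl, wreathAct_single,
        ← mul_assoc, ← wreathInl_add, hv, sub_add_cancel]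
    rw [h1]
    exact mul_mem (hK.conj_mem k hk _) (inv_mem hk)
  have key (x : GenWreath A Γ I) (hx : x ∈ K) : x.right • i = i ∨ x.right • i = k.right • i := by
    have h2 := DFunLike.congr_fun (wreathAct_eq_of_commute (hab x hx _ hvK)) (x.right • i)
    rw [wreathAct_apply_smul, hv] at h2
    simp only [Finsupp.sub_apply, Finsupp.single_apply, if_pos, if_neg hi, sub_zero] at h2
    by_contra! h3
    rw [if_neg h3.1.symm, if_neg h3.2.symm, sub_zero] at h2
    exact ha h2
  refine hinf i (k.right • i) hi.symm (Set.Finite.subset (Set.toFinite {i, k.right • i}) ?_)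
  rintro _ ⟨⟨σ, hσ⟩, rfl⟩
  have hσ' : σ⁻¹ • i = i := by rw [inv_smul_eq_iff]; exact hσ.symm
  have h3 := key _ (hK.conj_mem k hk (inr σ))
  have h4 : ((inr σ : GenWreath A Γ I) * k * (inr σ)⁻¹).right • i = σ • k.right • i := by
    change (σ * k.right * σ⁻¹) • i = _
    rw [mul_smul, mul_smul, hσ']
  rw [h4] at h3
  exact h3

/-- The center is abelian and normal, hence inside the base, and a finitely supported function
invariant under a transitive action on an infinite set vanishes. -/
theorem center_genWreath [Nontrivial A] [Nontrivial I] [FaithfulSMul Γ I]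
    [MulAction.IsPretransitive Γ I] : Subgroup.center (GenWreath A Γ I) = ⊥ := by
  rw [eq_bot_iff]
  intro g hg
  have hg' := Subgroup.mem_center_iff.1 hg
  have h1 : g.right = 1 := right_eq_one_of_mem_normal hinf inferInstance
    (fun x _ y hy => Subgroup.mem_center_iff.1 hy x) hg
  obtain ⟨i₀, j₀, hij⟩ := exists_pair_ne I
  have hI : Infinite I := Set.infinite_univ_iff.1 ((hinf i₀ j₀ hij).mono (Set.subset_univ _))
  have h2 (γ : Γ) : wreathAct γ g.left.toAdd = g.left.toAdd := by
    have := hg' (inr γ)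
    rw [eq_wreathInl h1] at this
    exact wreathAct_eq_of_commute (g := inr γ) this
  have h3 : g.left.toAdd = 0 := by
    by_contra hne
    obtain ⟨j, hj⟩ := Finsupp.ne_iff.1 hne
    refine Set.infinite_univ (α := I) (g.left.toAdd.hasFiniteSupport.subset ?_)
    intro k _
    obtain ⟨γ, rfl⟩ := MulAction.exists_smul_eq Γ j k
    change g.left.toAdd (γ • j) ≠ 0
    rw [← h2 γ, wreathAct_apply_smul]
    exact hj
  rw [Subgroup.mem_bot, eq_wreathInl h1, h3, wreathInl_zero]

theorem map_wreathInl_right [Nontrivial A] [FaithfulSMul Γ I]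
    (φ : GenWreath A Γ I ≃* GenWreath A Γ I) (a : I →₀ A) : (φ (wreathInl Γ a)).right = 1 := by
  have hn : ((inl : _ →* GenWreath A Γ I).range.map φ.toMonoidHom).Normal := by
    rw [range_inl_eq_ker_rightHom]
    exact Subgroup.Normal.map inferInstance _ φ.surjective
  refine right_eq_one_of_mem_normal hinf hn ?_ (k := φ (wreathInl Γ a)) ⟨_, ⟨_, rfl⟩, rfl⟩
  rintro _ ⟨_, ⟨a, rfl⟩, rfl⟩ _ ⟨_, ⟨b, rfl⟩, rfl⟩
  exact ((Commute.all a b).map inl).map φ.toMonoidHom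

/-- Automorphisms of the generalized wreath product restrict to the base. -/
theorem exists_addEquiv_of_mulAut [Nontrivial A] [FaithfulSMul Γ I]
    (φ : GenWreath A Γ I ≃* GenWreath A Γ I) :
    ∃ (ψ : (I →₀ A) ≃+ (I →₀ A)) (δ : Γ → Γ), (∀ a, φ (wreathInl Γ a) = wreathInl Γ (ψ a)) ∧
      ∀ γ a, ψ (wreathAct γ a) = wreathAct (δ γ) (ψ a) := by
  have h (φ : GenWreath A Γ I ≃* GenWreath A Γ I) (a : I →₀ A) :
      φ (wreathInl Γ a) = wreathInl Γ (φ (wreathInl Γ a)).left.toAdd :=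
    eq_wreathInl (map_wreathInl_right hinf φ a)
  let ψ : (I →₀ A) ≃+ (I →₀ A) :=
    { toFun := fun a => (φ (wreathInl Γ a)).left.toAdd
      invFun := fun a => (φ.symm (wreathInl Γ a)).left.toAdd
      left_inv := fun a => wreathInl_injective (Γ := Γ) (by
        change wreathInl Γ (φ.symm (wreathInl Γ (φ (wreathInl Γ a)).left.toAdd)).left.toAdd = _
        rw [← h φ.symm, ← h φ, φ.symm_apply_apply])
      right_inv := fun a => wreathInl_injective (Γ := Γ) (by
        change wreathInl Γ (φ (wreathInl Γ (φ.symm (wreathInl Γ a)).left.toAdd)).left.toAdd = _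
        rw [← h φ, ← h φ.symm, φ.apply_symm_apply])
      map_add' := fun a b => wreathInl_injective (Γ := Γ) (by
        rw [← h, wreathInl_add, wreathInl_add, ← h, ← h, map_mul]) }
  have hψ (a : I →₀ A) : φ (wreathInl Γ a) = wreathInl Γ (ψ a) := h φ a
  refine ⟨ψ, fun γ => (φ (inr γ)).right, hψ, fun γ a => wreathInl_injective (Γ := Γ) ?_⟩
  refine mul_right_cancel (b := φ (inr γ)) ?_
  rw [← mul_wreathInl, ← hψ, ← hψ, ← map_mul, ← map_mul]
  exact congrArg φ (mul_wreathInl (inr γ) a).symm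

/-- An equivariant automorphism of the base maps, for every `i`, some multiple of the generator at
`i` to the generator at some `j`. -/
theorem exists_single_eq_map_single (ψ : (I →₀ A) ≃+ (I →₀ A)) (δ : Γ → Γ)
    (h : ∀ γ a, ψ (wreathAct γ a) = wreathAct (δ γ) (ψ a)) (i : I) {a : A} (ha : a ≠ 0) :
    ∃ j b, ψ (Finsupp.single i b) = Finsupp.single j a := by
  have hne : ψ (Finsupp.single i a) ≠ 0 := by
    rw [Ne, EmbeddingLike.map_eq_zero_iff, Finsupp.single_eq_zero]; exact ha
  obtain ⟨j, hj⟩ := Finsupp.ne_iff.1 hne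
  set b := ψ.symm (Finsupp.single j a) with hb
  have hfin : (⋃ f ∈ (ψ (Finsupp.single i a)).support,
      ((ψ.symm (Finsupp.single f a)).support : Set I)).Finite :=
    -- If `σ` fixes `i`, then `δ σ • j` stays in the finite support of the image of the generator at
    -- `i`. Any other point `k` of the support of `b` would have its whole stabilizer orbit in this
    -- finite union.
    Set.Finite.biUnion (Finset.finite_toSet _) fun f _ => Finset.finite_toSet _
  have hsupp (k : I) (hk : b k ≠ 0) : k = i := by
    by_contra hki
    refine hinf i k (Ne.symm hki) (hfin.subset ?_)
    rintro _ ⟨⟨σ, hσ⟩, rfl⟩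
    have hσ' : σ • i = i := hσ
    refine Set.mem_iUnion₂.2 ⟨δ σ • j, ?_, ?_⟩
    · rw [Finsupp.mem_support_iff, ← hσ', ← wreathAct_single, h, wreathAct_apply_smul]
      exact hj
    · have h1 : ψ.symm (Finsupp.single (δ σ • j) a) = wreathAct σ b := by
        rw [AddEquiv.symm_apply_eq, h, hb, AddEquiv.apply_symm_apply, wreathAct_single]
      rw [h1, Finset.mem_coe, Finsupp.mem_support_iff]
      change wreathAct σ b (σ • k) ≠ 0
      rwa [wreathAct_apply_smul]
  refine ⟨j, b i, ?_⟩
  have h2 : Finsupp.single i (b i) = b := by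
    classical
    ext k
    rw [Finsupp.single_apply]
    split_ifs with hk
    · rw [hk]
    · by_contra hne
      exact hk (hsupp k (Ne.symm hne)).symm
  rw [h2, hb, AddEquiv.apply_symm_apply]

end WreathAut

/-! ### Central extensions and carry cocycles -/

section Extension

variable {G C : Type*} [Group G] [AddCommGroup C]

theorem CocycleExt.right_mul {z : Z2 G C} (x y : CocycleExt z) :
    (x * y).right = x.right * y.right := rfl

theorem CocycleExt.right_inv {z : Z2 G C} (x : CocycleExt z) : x⁻¹.right = x.right⁻¹ := rfl

theorem CocycleExt.right_pow {z : Z2 G C} (x : CocycleExt z) (m : ℕ) :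
    (x ^ m).right = x.right ^ m :=
  map_pow (CocycleExt.toGroupExtension z).rightHom x m

theorem CocycleExt.pow_eq {z : Z2 G C} (x : CocycleExt z) (m : ℕ) :
    x ^ m = ⟨m • x.left + ∑ k ∈ Finset.range m, z.1 (x.right ^ k) x.right, x.right ^ m⟩ := by
  induction m with
  | zero => simp [CocycleExt.one_def]
  | succ m ih =>
    rw [pow_succ, ih, CocycleExt.mul_def, Finset.sum_range_succ, succ_nsmul, pow_succ]
    refine CocycleExt.ext ?_ rfl
    rw [add_add_add_comm, ← add_assoc]

/-- Cohomologous cocycles define isomorphic extensions. -/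
theorem exists_mulEquiv_of_mk_eq {z z' : Z2 G C} (h : H2.mk z = H2.mk z') :
    ∃ e : CocycleExt z ≃* CocycleExt z', ∀ x, (e x).right = x.right := by
  obtain ⟨F, -, hF⟩ := QuotientAddGroup.eq.1 h
  have hF' (g k : G) : z'.1 g k = z.1 g k + (F g + F k - F (g * k)) := by
    rw [← hF]
    change _ = z.1 g k + (-z.1 g k + z'.1 g k)
    abel
  refine ⟨
    { toFun := fun x => ⟨x.left - F x.right, x.right⟩
      invFun := fun x => ⟨x.left + F x.right, x.right⟩
      left_inv := fun x => CocycleExt.ext (sub_add_cancel _ _) rfl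
      right_inv := fun x => CocycleExt.ext (add_sub_cancel_right _ _) rfl
      map_mul' := fun x y => CocycleExt.ext ?_ rfl }, fun x => rfl⟩
  simp only [CocycleExt.mul_def, hF']
  abel

/-- If `G` has trivial center, an isomorphism of central extensions of `G` induces an
automorphism of `G`. -/
theorem exists_mulEquiv_quotient (hG : Subgroup.center G = ⊥) {z z' : Z2 G C}
    (φ : CocycleExt z ≃* CocycleExt z') :
    ∃ ψ : G ≃* G, ∀ x, (φ x).right = ψ x.right := by
  -- Elements over the identity are central, so their images project into the trivial center of `G`.
  have h1 {z z' : Z2 G C} (φ : CocycleExt z ≃* CocycleExt z') (x : CocycleExt z)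
      (hx : x.right = 1) : (φ x).right = 1 := by
    rw [← Subgroup.mem_bot, ← hG, Subgroup.mem_center_iff]
    intro g
    obtain ⟨y, hy⟩ := φ.surjective ⟨0, g⟩
    have := Subgroup.mem_center_iff.1 (CocycleExt.mem_center_of_right_eq_one hx) y
    have h2 := congrArg (fun w => (φ w).right) this
    simpa [CocycleExt.right_mul, hy] using h2
  have h2 {z z' : Z2 G C} (φ : CocycleExt z ≃* CocycleExt z') (x : CocycleExt z) :
      (φ x).right = (φ ⟨0, x.right⟩).right := by
    have := h1 φ (x * (⟨0, x.right⟩ : CocycleExt z)⁻¹) (mul_inv_cancel _)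
    rwa [map_mul, map_inv, CocycleExt.right_mul, CocycleExt.right_inv, mul_inv_eq_one] at this
  refine ⟨
    { toFun := fun g => (φ ⟨0, g⟩).right
      invFun := fun g => (φ.symm ⟨0, g⟩).right
      left_inv := fun g => by
        change (φ.symm ⟨0, (φ ⟨0, g⟩).right⟩).right = g
        rw [← h2 φ.symm, φ.symm_apply_apply]
      right_inv := fun g => by
        change (φ ⟨0, (φ.symm ⟨0, g⟩).right⟩).right = g
        rw [← h2 φ, φ.apply_symm_apply]
      map_mul' := fun g h => by
        rw [← CocycleExt.right_mul, ← map_mul]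
        exact (h2 φ (⟨0, g⟩ * ⟨0, h⟩)).symm }, h2 φ⟩

/-- Every central extension is given by a cocycle. -/
theorem exists_cocycleExt_mulEquiv {E : Type*} [Group E]
    (S : GroupExtension (Multiplicative C) E G) (hS : IsCentralExtension S) :
    ∃ z : Z2 G C, Nonempty (CocycleExt z ≃* E) := by
  classical
  have hcomm (c : Multiplicative C) (x : E) : x * S.inl c = S.inl c * x :=
    Subgroup.mem_center_iff.1 (hS ⟨c, rfl⟩) x
  -- The section is adjusted at the identity so that its cocycle is normalized.
  obtain ⟨σ, hσ, hσ1⟩ : ∃ σ : G → E, (∀ g, S.rightHom (σ g) = g) ∧ σ 1 = 1 := by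
    choose τ hτ using S.rightHom_surjective
    refine ⟨Function.update τ 1 1, fun g => ?_, Function.update_self _ _ _⟩
    by_cases hg : g = 1
    · subst hg; rw [Function.update_self, map_one]
    · rw [Function.update_of_ne hg, hτ]
  have hker (x : E) (hx : S.rightHom x = 1) : ∃ c : C, S.inl (Multiplicative.ofAdd c) = x := by
    have : x ∈ S.inl.range := by rw [S.range_inl_eq_ker_rightHom]; exact hx
    obtain ⟨c, hc⟩ := this
    exact ⟨c.toAdd, hc⟩
  have hz (g h : G) : ∃ c : C, S.inl (Multiplicative.ofAdd c) * σ (g * h) = σ g * σ h := by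
    obtain ⟨c, hc⟩ := hker (σ g * σ h * (σ (g * h))⁻¹) (by simp [hσ])
    exact ⟨c, by rw [hc, inv_mul_cancel_right]⟩
  choose z hz using hz
  have hinj {a b : C} (x : E)
      (h : S.inl (Multiplicative.ofAdd a) * x = S.inl (Multiplicative.ofAdd b) * x) : a = b :=
    S.inl_injective (mul_right_cancel h)
  have hadd (a b : C) : S.inl (Multiplicative.ofAdd (a + b)) =
      S.inl (Multiplicative.ofAdd a) * S.inl (Multiplicative.ofAdd b) :=
    map_mul S.inl (Multiplicative.ofAdd a) (Multiplicative.ofAdd b)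
  let Z : Z2 G C := ⟨z, fun g h k => hinj (σ (g * h * k)) (by
      trans σ g * σ h * σ k
      · rw [hadd, mul_assoc, hz, ← mul_assoc, hz]
      · rw [add_comm, mul_assoc g, hadd, mul_assoc (S.inl _), hz g (h * k), ← mul_assoc (S.inl _),
          ← hcomm _ (σ g), mul_assoc (σ g), mul_assoc (σ g), hz h k]),
    fun g => ⟨hinj (σ g) (by
        have := hz g 1
        rw [mul_one, hσ1, mul_one] at this
        rw [this, ofAdd_zero, map_one, one_mul]), hinj (σ g) (by
        have := hz 1 g
        rw [one_mul, hσ1, one_mul] at this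
        rw [this, ofAdd_zero, map_one, one_mul])⟩⟩
  let f : CocycleExt Z →* E :=
    { toFun := fun x => S.inl (Multiplicative.ofAdd x.left) * σ x.right
      map_one' := by
        change S.inl (Multiplicative.ofAdd 0) * σ 1 = 1
        rw [hσ1, ofAdd_zero, map_one, one_mul]
      map_mul' := fun x y => by
        change S.inl (Multiplicative.ofAdd (x.left + y.left + z x.right y.right)) *
          σ (x.right * y.right) = _
        rw [hadd, mul_assoc, hz, hadd, mul_assoc, mul_assoc,
          ← mul_assoc (σ x.right), hcomm _ (σ x.right)]
        simp only [mul_assoc] }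
  have hr (a : C) : S.rightHom (S.inl (Multiplicative.ofAdd a)) = 1 :=
    S.rightHom_inl _
  have hfr (x : CocycleExt Z) : S.rightHom (f x) = x.right := by
    change S.rightHom (S.inl (Multiplicative.ofAdd x.left) * σ x.right) = x.right
    rw [map_mul, hr, hσ, one_mul]
  refine ⟨Z, ⟨MulEquiv.ofBijective f ⟨fun x y hxy => ?_, fun x => ?_⟩⟩⟩
  · have h1 : x.right = y.right := by rw [← hfr, hxy, hfr]
    refine CocycleExt.ext (hinj (σ x.right) ?_) h1
    have h2 : S.inl (Multiplicative.ofAdd x.left) * σ x.right =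
      S.inl (Multiplicative.ofAdd y.left) * σ y.right := hxy
    rw [h2, h1]
  · obtain ⟨c, hc⟩ := hker (x * (σ (S.rightHom x))⁻¹) (by simp [hσ])
    exact ⟨⟨c, S.rightHom x⟩, by
      change S.inl (Multiplicative.ofAdd c) * σ (S.rightHom x) = x
      rw [hc, inv_mul_cancel_right]⟩

/-- The inflation to `G` of the carry cocycle `(a, b) ↦ ⌊(a + b) / n⌋ • c` on `ℤ/nℤ`. -/
def carryCocycle {n : ℕ} [NeZero n] (s : G → ZMod n) (hs : ∀ g h, s (g * h) = s g + s h) (c : C) :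
    Z2 G C :=
  ⟨fun g h => (((s g).val + (s h).val) / n) • c, by
    have hs1 : s 1 = 0 := by simpa using hs 1 1
    refine ⟨fun g h k => ?_, fun g => ?_⟩
    · rw [← add_nsmul, ← add_nsmul]
      congr 1
      -- After multiplication by `n`, both sides are the sum of the three residues minus the residue
      -- of the total.
      apply Nat.eq_of_mul_eq_mul_left (NeZero.pos n)
      have h1 := val_add_val_eq (s g) (s h)
      have h2 := val_add_val_eq (s (g * h)) (s k)
      have h3 := val_add_val_eq (s g) (s (h * k))
      have h4 := val_add_val_eq (s h) (s k)
      rw [hs] at h2 h3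
      rw [hs, hs, mul_add, mul_add]
      rw [← add_assoc] at h3
      omega
    · simp [hs1, Nat.div_eq_of_lt (ZMod.val_lt (s g))]⟩

theorem exists_nsmul_eq_circle {n : ℕ} (hn : n ≠ 0) (w : Additive Circle) :
    ∃ r : Additive Circle, n • r = w := by
  refine ⟨Additive.ofMul (Circle.exp (Complex.arg w.toMul / n)), ?_⟩
  have hn' : (n : ℝ) ≠ 0 := by exact_mod_cast hn
  apply Additive.toMul.injective
  rw [toMul_nsmul, toMul_ofMul, ← Circle.exp_nsmul, nsmul_eq_mul, mul_div_cancel₀ _ hn',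
    Circle.exp_arg]

/-- Divisibility of the circle gives `r` with `n • r = ω c`, and `(s g).val • r` is a primitive of
the carry cocycle after `ω`. -/
theorem cohApprox_add_carry {n : ℕ} [NeZero n] (s : G → ZMod n)
    (hs : ∀ g h, s (g * h) = s g + s h) (c : C) (z : Z2 G C) :
    CohApprox (H2.mk z) (H2.mk (z + carryCocycle s hs c)) := by
  intro ω
  have hs1 : s 1 = 0 := by simpa using hs 1 1
  obtain ⟨r, hr⟩ := exists_nsmul_eq_circle (NeZero.ne n) (ω c)
  refine QuotientAddGroup.eq.2 ⟨fun g => (s g).val • r, by simp [hs1], fun g h => ?_⟩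
  change -ω (z.1 g h) + ω (z.1 g h + (((s g).val + (s h).val) / n) • c) = _
  rw [map_add, neg_add_cancel_left, map_nsmul, ← hr, ← mul_nsmul, eq_sub_iff_add_eq, ← add_nsmul,
    ← add_nsmul]
  refine congrArg (· • r) ?_
  rw [hs, add_comm]
  exact (val_add_val_eq _ _).symm

/-- Along a power sequence the carries add up to one. -/
theorem sum_carryCocycle {n : ℕ} [NeZero n] (hn : 1 < n) (s : G → ZMod n)
    (hs : ∀ g h, s (g * h) = s g + s h) (c : C) {g : G} (hg : s g = 1) :
    ∑ k ∈ Finset.range n, (carryCocycle s hs c).1 (g ^ k) g = c := by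
  have hs1 : s 1 = 0 := by simpa using hs 1 1
  have hpow (k : ℕ) : s (g ^ k) = k := by
    induction k with
    | zero => simpa using hs1
    | succ k ih => rw [pow_succ, hs, ih, hg, Nat.cast_succ]
  have : Fact (1 < n) := ⟨hn⟩
  change ∑ k ∈ Finset.range n, (((s (g ^ k)).val + (s g).val) / n) • c = c
  rw [← Finset.sum_smul]
  have h1 (m : ℕ) : n * ∑ k ∈ Finset.range m, ((s (g ^ k)).val + (s g).val) / n +
      (s (g ^ m)).val = m := by
    induction m with
    | zero => simp [hs1]
    | succ m ih =>
      have h2 := val_add_val_eq (s (g ^ m)) (s g)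
      rw [← hs, ← pow_succ, hg, ZMod.val_one] at h2
      rw [Finset.sum_range_succ, mul_add, hg, ZMod.val_one]
      rw [hg, ZMod.val_one] at ih
      omega
  have h2 := h1 n
  rw [hpow, ZMod.natCast_self, ZMod.val_zero, add_zero] at h2
  have h3 : ∑ k ∈ Finset.range n, ((s (g ^ k)).val + (s g).val) / n = 1 :=
    Nat.eq_of_mul_eq_mul_left (NeZero.pos n) (by rw [h2, mul_one])
  rw [h3, one_nsmul]

end Extension

/-! ### The torsion-lift invariant -/

section WreathExtension

variable {Γ I C : Type*} [Group Γ] [MulAction Γ I] [AddCommGroup C] {n : ℕ}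

/-- The sum of the coordinates, a homomorphism from the generalized wreath product. -/
noncomputable def wreathSum {A : Type*} [AddCommGroup A] (g : GenWreath A Γ I) : A :=
  Finsupp.liftAddHom (fun _ : I => AddMonoidHom.id A) g.left.toAdd

theorem wreathSum_mul {A : Type*} [AddCommGroup A] (g h : GenWreath A Γ I) :
    wreathSum (g * h) = wreathSum g + wreathSum h := by
  have h1 : (Finsupp.liftAddHom (fun _ : I => AddMonoidHom.id A)).comp
      (AddEquiv.toAddMonoidHom (Finsupp.domCongr (MulAction.toPerm g.right))) =
      Finsupp.liftAddHom (fun _ : I => AddMonoidHom.id A) := by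
    ext i a
    simp
  have h2 := DFunLike.congr_fun h1 h.left.toAdd
  exact (map_add (Finsupp.liftAddHom fun _ : I => AddMonoidHom.id A) g.left.toAdd
    (wreathAct g.right h.left.toAdd)).trans (congrArg _ h2)

theorem wreathSum_wreathInl_single {A : Type*} [AddCommGroup A] (i : I) (a : A) :
    wreathSum (wreathInl Γ (Finsupp.single i a)) = a := by
  simp [wreathSum, wreathInl_left]

/-- Some coordinate generator of the base lifts to an element of the extension whose `n`-th
power is trivial. -/
def HasTorsionLift (z : Z2 (GenWreath (ZMod n) Γ I) C) : Prop :=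
  ∃ i, ∃ x : CocycleExt z, x.right = wreathInl Γ (Finsupp.single i 1) ∧ x ^ n = 1

theorem wreathInl_single_pow (i : I) :
    wreathInl Γ (Finsupp.single i (1 : ZMod n)) ^ n = 1 := by
  rw [← wreathInl_nsmul, Finsupp.smul_single, nsmul_one, ZMod.natCast_self, Finsupp.single_zero,
    wreathInl_zero]

/-- Conjugation by lifts of `Γ` makes the choice of coordinate irrelevant. Changing a lift by `c`
changes its `n`-th power by `n • c`, so the obstruction is a single class in `C / nC`. -/
theorem hasTorsionLift_iff [MulAction.IsPretransitive Γ I] (z : Z2 (GenWreath (ZMod n) Γ I) C)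
    (i : I) : HasTorsionLift z ↔ ∃ c : C, n • c + ∑ k ∈ Finset.range n,
      z.1 (wreathInl Γ (Finsupp.single i 1) ^ k) (wreathInl Γ (Finsupp.single i 1)) = 0 := by
  constructor
  · rintro ⟨j, x, hx, hxn⟩
    obtain ⟨γ, rfl⟩ := MulAction.exists_smul_eq Γ j i
    set y : CocycleExt z := ⟨0, SemidirectProduct.inr γ⟩
    have h1 : (y * x * y⁻¹).right = wreathInl Γ (Finsupp.single (γ • j) 1) := by
      rw [CocycleExt.right_mul, CocycleExt.right_mul, CocycleExt.right_inv, hx, mul_wreathInl,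
        mul_inv_cancel_right, wreathAct_single]
      rfl
    have h2 : (y * x * y⁻¹) ^ n = 1 := by rw [conj_pow, hxn, mul_one, mul_inv_cancel]
    rw [CocycleExt.pow_eq, h1] at h2
    exact ⟨_, congrArg CocycleExt.left h2⟩
  · rintro ⟨c, hc⟩
    refine ⟨i, ⟨c, wreathInl Γ (Finsupp.single i 1)⟩, rfl, ?_⟩
    rw [CocycleExt.pow_eq]
    exact CocycleExt.ext hc (wreathInl_single_pow i)

theorem HasTorsionLift.of_mk_eq {z z' : Z2 (GenWreath (ZMod n) Γ I) C}
    (h : H2.mk z = H2.mk z') (hz : HasTorsionLift z) : HasTorsionLift z' := by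
  obtain ⟨e, he⟩ := exists_mulEquiv_of_mk_eq h
  obtain ⟨i, x, hx, hxn⟩ := hz
  exact ⟨i, e x, (he x).trans hx, by rw [← map_pow, hxn, map_one]⟩

variable (hinf : ∀ i j : I, i ≠ j → (MulAction.orbit (MulAction.stabilizer Γ i) j).Infinite)

include hinf

theorem HasTorsionLift.of_mulEquiv [Nontrivial I] [FaithfulSMul Γ I]
    [MulAction.IsPretransitive Γ I] [Fact (1 < n)] {z z' : Z2 (GenWreath (ZMod n) Γ I) C}
    (φ : CocycleExt z ≃* CocycleExt z') (hz : HasTorsionLift z) : HasTorsionLift z' := by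
  have : NeZero n := ⟨(zero_lt_one.trans (Fact.out : 1 < n)).ne'⟩
  obtain ⟨Φ, hΦ⟩ := exists_mulEquiv_quotient (center_genWreath hinf) φ
  obtain ⟨ψ, δ, hψ, hδ⟩ := exists_addEquiv_of_mulAut hinf Φ
  obtain ⟨i, x, hx, hxn⟩ := hz
  -- Although the generator at `i` itself need not go to a generator, its multiple by `b` does, and
  -- the corresponding power of the torsion lift is still torsion.
  obtain ⟨j, b, hb⟩ := exists_single_eq_map_single hinf ψ δ hδ i (one_ne_zero (α := ZMod n))
  refine ⟨j, φ x ^ b.val, ?_, ?_⟩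
  · rw [CocycleExt.right_pow, hΦ, hx, hψ, ← wreathInl_nsmul, ← map_nsmul, Finsupp.smul_single,
      nsmul_one, ZMod.natCast_zmod_val, hb]
  · rw [← pow_mul, mul_comm, pow_mul, ← map_pow, hxn, map_one, one_pow]

/-- Every class has an approximately cohomologous class such that the extensions have isomorphic
group von Neumann algebras but are not isomorphic. -/
theorem exists_cohApprox_not_mulEquiv [Nontrivial I] [FaithfulSMul Γ I]
    [MulAction.IsPretransitive Γ I] (hn : 1 ≤ n)
    (hC : Set.range (fun c : C => n • c) ≠ Set.univ) (Ω : H2 (GenWreath (ZMod n) Γ I) C) :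
    ∃ Ω' : H2 (GenWreath (ZMod n) Γ I) C, CohApprox Ω Ω' ∧
      ∀ z z' : Z2 (GenWreath (ZMod n) Γ I) C, H2.mk z = Ω → H2.mk z' = Ω' →
        GroupVNIso (CocycleExt z) (CocycleExt z') ∧
        ¬ Nonempty (CocycleExt z ≃* CocycleExt z') := by
  have hn1 : 1 < n := by
    refine lt_of_le_of_ne hn ?_
    rintro rfl
    exact hC (Set.eq_univ_of_forall fun c => ⟨c, one_nsmul c⟩)
  have : Fact (1 < n) := ⟨hn1⟩
  have : NeZero n := ⟨(zero_lt_one.trans hn1).ne'⟩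
  obtain ⟨c₁, hc₁⟩ := (Set.ne_univ_iff_exists_notMem _).1 hC
  obtain ⟨i, -⟩ := exists_pair_ne I
  obtain ⟨w, rfl⟩ := QuotientAddGroup.mk_surjective Ω
  let q (c : C) := carryCocycle (wreathSum (A := ZMod n) (Γ := Γ) (I := I)) wreathSum_mul c
  obtain ⟨c, hc⟩ : ∃ c : C, ¬ (HasTorsionLift w ↔ HasTorsionLift (w + q c)) := by
    have hsum (c : C) : ∑ k ∈ Finset.range n, (w + q c).1
        (wreathInl Γ (Finsupp.single i 1) ^ k) (wreathInl Γ (Finsupp.single i 1)) =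
        ∑ k ∈ Finset.range n, w.1
          (wreathInl Γ (Finsupp.single i 1) ^ k) (wreathInl Γ (Finsupp.single i 1)) + c := by
      have h1 := sum_carryCocycle hn1 (wreathSum (A := ZMod n) (Γ := Γ) (I := I)) wreathSum_mul c
        (wreathSum_wreathInl_single i 1)
      conv_rhs => rw [← h1]
      exact Finset.sum_add_distrib
    -- A vanishing obstruction is made nonzero by adding `c₁ ∉ nC`; a nonzero one is cancelled by
    -- adding its negative.
    by_cases hw : HasTorsionLift w
    · refine ⟨c₁, fun h => hc₁ ?_⟩
      obtain ⟨a, ha⟩ := (hasTorsionLift_iff w i).1 hw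
      obtain ⟨b, hb⟩ := (hasTorsionLift_iff _ i).1 (h.1 hw)
      rw [hsum] at hb
      refine ⟨a - b, ?_⟩
      change n • (a - b) = c₁
      rw [nsmul_sub, eq_neg_of_add_eq_zero_left ha, eq_neg_of_add_eq_zero_left hb]
      abel
    · refine ⟨-∑ k ∈ Finset.range n, w.1
          (wreathInl Γ (Finsupp.single i 1) ^ k) (wreathInl Γ (Finsupp.single i 1)),
        fun h => hw (h.2 ((hasTorsionLift_iff _ i).2 ⟨0, ?_⟩))⟩
      rw [hsum, nsmul_zero, add_neg_cancel, add_zero]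
  refine ⟨H2.mk (w + q c), cohApprox_add_carry _ wreathSum_mul c w, fun z z' hz hz' => ⟨?_, ?_⟩⟩
  · obtain ⟨e, -⟩ := exists_mulEquiv_of_mk_eq (z := z) (z' := w) hz
    obtain ⟨e', -⟩ := exists_mulEquiv_of_mk_eq hz'
    exact ((GroupVNIso.of_mulEquiv e).trans
      (groupVNIso_of_carry w (w + q c) c wreathSum wreathSum_mul fun _ _ => rfl).symm).trans
      (GroupVNIso.of_mulEquiv e').symm
  · rintro ⟨φ⟩
    refine hc ⟨fun h => ?_, fun h => ?_⟩
    · exact ((h.of_mk_eq (z' := z) hz.symm).of_mulEquiv hinf φ).of_mk_eq hz'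
    · exact ((h.of_mk_eq hz'.symm).of_mulEquiv hinf φ.symm).of_mk_eq (z' := w) hz

end WreathExtension

/-! ### Countability and the failure of superrigidity -/

theorem countable_genWreath {A Γ I : Type*} [AddCommGroup A] [Countable A] [Group Γ] [Countable Γ]
    [MulAction Γ I] [Nonempty I] [MulAction.IsPretransitive Γ I] :
    Countable (GenWreath A Γ I) := by
  obtain ⟨i⟩ := ‹Nonempty I›
  have : Countable I := (MulAction.surjective_smul Γ i).countable
  have h : Function.Injective fun g : GenWreath A Γ I => (g.left.toAdd, g.right) := by
    intro g h hgh
    exact SemidirectProduct.ext (congrArg Prod.fst hgh) (congrArg Prod.snd hgh)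
  exact h.countable

end GroupVN

theorem mainTheorem8 {Γ I C : Type*} [Group Γ] [Countable Γ] [Nontrivial I]
    [MulAction Γ I] [FaithfulSMul Γ I] [MulAction.IsPretransitive Γ I]
    (hinf : ∀ i j : I, i ≠ j → (MulAction.orbit (MulAction.stabilizer Γ i) j).Infinite)
    (n : ℕ) (hn : 1 ≤ n)
    [AddCommGroup C] [Countable C]
    (hC : Set.range (fun c : C => n • c) ≠ Set.univ) :
    (∀ (E : Type*) [Group E]
        (S : GroupExtension (Multiplicative C) E (GenWreath (ZMod n) Γ I)),
        IsCentralExtension S → ¬ IsWStarSuperrigid E) ∧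
    (∀ Ω : H2 (GenWreath (ZMod n) Γ I) C, ∃ Ω' : H2 (GenWreath (ZMod n) Γ I) C,
        CohApprox Ω Ω' ∧
        ∀ z z' : Z2 (GenWreath (ZMod n) Γ I) C, H2.mk z = Ω → H2.mk z' = Ω' →
          GroupVNIso (CocycleExt z) (CocycleExt z') ∧
          ¬ Nonempty (CocycleExt z ≃* CocycleExt z')) := by
  refine ⟨fun E _ S hS hE => ?_, exists_cohApprox_not_mulEquiv hinf hn hC⟩
  obtain ⟨z, ⟨e⟩⟩ := exists_cocycleExt_mulEquiv S hS
  obtain ⟨Ω', -, h⟩ := exists_cohApprox_not_mulEquiv hinf hn hC (H2.mk z)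
  obtain ⟨z', rfl⟩ := QuotientAddGroup.mk_surjective Ω'
  obtain ⟨h1, h2⟩ := h z z' rfl rfl
  have : NeZero n := ⟨(zero_lt_one.trans_le hn).ne'⟩
  have : Countable (GenWreath (ZMod n) Γ I) := countable_genWreath
  have : Countable (CocycleExt z') :=
    Function.Injective.countable (f := fun x : CocycleExt z' => (x.left, x.right))
      fun x y hxy => CocycleExt.ext (congrArg Prod.fst hxy) (congrArg Prod.snd hxy)
  -- Superrigidity tests only groups in the lowest universe, so the countable competitor is replaced
  -- by a copy there.
  let s : Shrink.{0} (CocycleExt z') ≃* CocycleExt z' := Shrink.mulEquiv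
  have : Countable (Shrink.{0} (CocycleExt z')) := s.injective.countable
  obtain ⟨f⟩ := (hE (Shrink.{0} (CocycleExt z'))).1
    (((GroupVNIso.of_mulEquiv e.symm).trans h1).trans (GroupVNIso.of_mulEquiv s.symm))
  exact h2 ⟨(e.trans f).trans s⟩
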